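/- Let $N\ge 8$ be an integer and let $\mathcal P_{2,N+1}$ be the complex vector space of quadratic forms in $N+1$ variables, that is, of quadratic forms on the complex projective space $\mathbb P^N$. Let $\mathcal Y\subset\mathcal P_{2,N+1}\times\mathcal P_{2,N+1}$ be the set of pairs $(g_1,g_2)$ such that the set of common zeros $$Z(g_1,g_2)=\{g_1=g_2=0\}\subset\mathbb P^N$$ is an irreducible reduced complete intersection of codimension $2$ (that is, $Z(g_1,g_2)$ is irreducible of codimension $2$ in $\mathbb P^N$ and its homogeneous ideal is generated by $g_1,g_2$) and, moreover, its singular locus satisfies $$\operatorname{codim}\bigl(\operatorname{Sing} Z(g_1,g_2)\subset\mathbb P^N\bigr)\ge 6,$$ where the empty set is regarded as having infinite codimension. Then the codimension of the complement of $\mathcal Y$ (that is, of its Zariski closure) in the affine space $\mathcal P_{2,N+1}\times\mathcal P_{2,N+1}$ is at least $$\tfrac12(N-4)(N-3)-2.$$ -/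

import Mathlib

open scoped LinearAlgebra.Projectivization

noncomputable section

/-! Projective geometry over `ℂ` in classical language: closed subsets of
`ℙ^N = ℙ ℂ (Fin (N + 1) → ℂ)` with the Zariski topology, their vanishing ideals,
codimension and singular points; then pairs of quadratic forms. -/

namespace TwoQuadrics

/-- The codimension in the affine space `ℂ^σ` of an arbitrary subset `S`, that is, the
codimension of its Zariski closure: the height of the ideal of all polynomials vanishing
on `S` (the minimum of the codimensions of the irreducible components of the closure;
it is `⊤` for the empty set). -/
def affineCodim {σ : Type} (S : Set (σ → ℂ)) : ℕ∞ :=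
  (MvPolynomial.vanishingIdeal ℂ S).height

/-- The projective space `ℙ^N` over `ℂ`, as a set of points. -/
abbrev PSpace (N : ℕ) : Type := ℙ ℂ (Fin (N + 1) → ℂ)

/-- The Zariski topology on `ℙ^N`: generated by the complements `{f ≠ 0}` of the
hypersurfaces, where `f` is a homogeneous polynomial. -/
@[reducible]
def zariski (N : ℕ) : TopologicalSpace (PSpace N) :=
  TopologicalSpace.generateFrom
    {U | ∃ (d : ℕ) (f : MvPolynomial (Fin (N + 1)) ℂ), f.IsHomogeneous d ∧
      U = {p : PSpace N | MvPolynomial.eval p.rep f ≠ 0}}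

/-- The punctured affine cone over a subset of `ℙ^N`: all homogeneous coordinate vectors of
its points. -/
def cone {N : ℕ} (Z : Set (PSpace N)) : Set (Fin (N + 1) → ℂ) :=
  {x | ∃ h : x ≠ 0, Projectivization.mk ℂ x h ∈ Z}

/-- The homogeneous ideal `I(Z)` of a subset of `ℙ^N`: the polynomials that vanish on the
cone over `Z`. (As `ℂ` is infinite, it is generated by the homogeneous polynomials that
vanish on `Z`.) -/
def projIdeal {N : ℕ} (Z : Set (PSpace N)) : Ideal (MvPolynomial (Fin (N + 1)) ℂ) :=
  MvPolynomial.vanishingIdeal ℂ (cone Z)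

/-- The codimension in `ℙ^N` of a subset `Z` (of its Zariski closure), which is the
codimension of the cone over `Z`; it is `⊤` for the empty set. -/
def projCodim {N : ℕ} (Z : Set (PSpace N)) : ℕ∞ := affineCodim (cone Z)

/-- The gradient of the polynomial `f` at the vector `x`. -/
def gradient {N : ℕ} (f : MvPolynomial (Fin (N + 1)) ℂ) (x : Fin (N + 1) → ℂ) :
    Fin (N + 1) → ℂ :=
  fun i => MvPolynomial.eval x (MvPolynomial.pderiv i f)

/-- The singular locus of an irreducible closed subset `Z ⊆ ℙ^N`: the points of `Z` at which
the gradients of the elements of `I(Z)` span a space of dimension less than the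
codimension of `Z` (equivalently, the Zariski tangent space is of dimension greater
than `dim Z`). -/
def singularLocus {N : ℕ} (Z : Set (PSpace N)) : Set (PSpace N) :=
  {p ∈ Z | ((Module.finrank ℂ (Submodule.span ℂ
      {v | ∃ f ∈ projIdeal Z, v = gradient f p.rep}) : ℕ) : ℕ∞) < projCodim Z}

/-- The set of common zeros `{g₁ = g₂ = 0} ⊆ ℙ^N` of two homogeneous polynomials. -/
def commonZeros {N : ℕ} (g₁ g₂ : MvPolynomial (Fin (N + 1)) ℂ) : Set (PSpace N) :=
  {p | MvPolynomial.eval p.rep g₁ = 0 ∧ MvPolynomial.eval p.rep g₂ = 0}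

/-- `{g₁ = g₂ = 0}` is an irreducible reduced complete intersection of codimension 2:
the set of common zeros is irreducible and of codimension 2, and the two equations generate
its whole homogeneous ideal (so the scheme that they define is reduced). -/
structure IsIntegralCompleteIntersection {N : ℕ}
    (g₁ g₂ : MvPolynomial (Fin (N + 1)) ℂ) : Prop where
  irreducible : @IsIrreducible _ (zariski N) (commonZeros g₁ g₂)
  codim_eq_two : projCodim (commonZeros g₁ g₂) = 2
  ideal_eq : projIdeal (commonZeros g₁ g₂) = Ideal.span {g₁, g₂}

/-- The space of pairs of quadratic forms on `ℙ^N`, with the coefficients as coordinates: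
`c (i, s(j, k))` is the coefficient of `x_j x_k` in the `i`-th form. -/
abbrev PairSpace (N : ℕ) : Type := Fin 2 × Sym2 (Fin (N + 1)) → ℂ

/-- The `i`-th quadratic form `∑ c (i, s(j, k)) x_j x_k` of the pair `c`, the sum being over the
unordered pairs `s(j, k)`. -/
def quadForm {N : ℕ} (c : PairSpace N) (i : Fin 2) : MvPolynomial (Fin (N + 1)) ℂ :=
  ∑ s : Sym2 (Fin (N + 1)),
    MvPolynomial.C (c (i, s)) * (s.map (MvPolynomial.X (R := ℂ))).mul

/-- The set of regular pairs `(g₁, g₂)`: the set `{g₁ = g₂ = 0}` is an irreducible reduced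
complete intersection of codimension 2, with singular locus of codimension at least 6
in `ℙ^N`. -/
def regularPairs (N : ℕ) : Set (PairSpace N) :=
  {c | IsIntegralCompleteIntersection (quadForm c 0) (quadForm c 1) ∧
    6 ≤ projCodim (singularLocus (commonZeros (quadForm c 0) (quadForm c 1)))}

end TwoQuadrics

end

/-! Identify the two forms with symmetric matrices `S`, `T` of size N+1. A pair is regular as soon
as S - tT and T - tS have rank at least 6 for all t and one of `S`, `T` has rank at least 7
(`mem_regularPairs`). The complement of the regular pairs therefore lies in three sets: some S - tT
has rank at most 5, some T - tS has rank at most 5, or both forms have rank at most 6. Each is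
covered by finitely many polynomial images of affine spaces. Symmetric matrices of rank at most r
have codimension (N+1-r)(N+2-r)/2. Hence the first two sets have codimension at least (N-4)(N-3)/2 -
1, the scalar t costing one, and the third at least (N-5)(N-4).

Why such pairs are regular. The ring of a quadric of rank at least 5 is factorial
(`uniqueFactorizationMonoid_quadric`): over ℂ the form is xy + b with b irreducible, and Nagata's
criterion applies to the prime element y, since inverting y eliminates x. In this factorial ring the
second form is irreducible: a proper factorization would make some member T - cS a product of two
linear forms, of rank at most 2. So the two forms generate a prime ideal (`isPrime_span_pair`). It
has height 2, and by the Nullstellensatz it is the ideal of the common zeros.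

At a singular point x the gradients Sx and Tx are dependent, so x lies in the kernel of a nonzero
member of the pencil (`le_affineCodim_pencil_ker`). All but finitely many members have rank at least
7, and their kernels sweep out codimension at least 7 - 1 = 6. Each remaining kernel has codimension
at least 6 because its member has rank at least 6.

Codimension is a height of a vanishing ideal, so the dimension counts rest on one inequality: the
relations between n polynomials in m variables form an ideal of height at least n - m
(`card_le_height_ker_add_card`). -/

/-! ### Heights of ideals of relations -/

/-- The extension of a prime ideal of `R` to `R[X]` has at least the same height. -/
theorem Ideal.height_le_height_map_C {R : Type*} [CommRing R]
    (p : Ideal R) [hp : p.IsPrime] : p.height ≤ (p.map (Polynomial.C)).height := by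
  have : (p.map (Polynomial.C)).IsPrime := (Ideal.isPrime_map_C_iff_isPrime p).2 hp
  let F : PrimeSpectrum R → PrimeSpectrum (Polynomial R) := fun q =>
    ⟨q.asIdeal.map Polynomial.C, (Ideal.isPrime_map_C_iff_isPrime _).2 q.2⟩
  have hF : StrictMono F := by
    refine Monotone.strictMono_of_injective (fun a b h => Ideal.map_mono h) fun a b h => ?_
    ext x
    have h' : a.asIdeal.map Polynomial.C = b.asIdeal.map Polynomial.C :=
      congrArg PrimeSpectrum.asIdeal h
    -- The degree-zero coefficients recover an ideal from its extension, so extending primes is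
    -- injective.
    have key : ∀ I : Ideal R, x ∈ I ↔ Polynomial.C x ∈ I.map Polynomial.C := fun I => by
      refine ⟨Ideal.mem_map_of_mem _, fun h => ?_⟩
      simpa using Ideal.mem_map_C_iff.1 h 0
    rw [key, key, h']
  have h := Order.height_le_height_apply_of_strictMono F hF ⟨p, hp⟩
  rwa [← PrimeSpectrum.height_eq_orderHeight, ← PrimeSpectrum.height_eq_orderHeight] at h

namespace MvPolynomial

theorem optionEquivLeft_rename {R σ κ : Type*} [CommSemiring R] (e : κ → σ)
    (p : MvPolynomial (Option κ) R) :
    optionEquivLeft R σ (rename (Option.map e) p) =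
      Polynomial.map (rename e : MvPolynomial κ R →ₐ[R] MvPolynomial σ R).toRingHom
        (optionEquivLeft R κ p) := by
  induction p using MvPolynomial.induction_on with
  | C a => simp [optionEquivLeft_apply]
  | add p q hp hq => simp [hp, hq]
  | mul_X p i hp =>
    rw [map_mul, map_mul, hp, map_mul, Polynomial.map_mul]
    congr 1
    cases i <;> simp [optionEquivLeft_apply]

/-- Among the values of a family `f` there are algebraically independent ones whose number
plus the height of the ideal of relations is at least the number of variables. -/
theorem exists_algebraicIndependent_card_le_height_add {k L : Type} [Field k] [CommRing L]
    [IsDomain L] [Algebra k L] (σ : Type) [Finite σ] : ∀ f : σ → L,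
    ∃ (κ : Type) (_ : Finite κ) (e : κ → σ), AlgebraicIndependent k (f ∘ e) ∧
      (Nat.card σ : ℕ∞) ≤
        (RingHom.ker (aeval f : MvPolynomial σ k →ₐ[k] L)).height + Nat.card κ := by
  induction σ using Finite.induction_empty_option with
  | of_equiv a IH =>
    intro f
    obtain ⟨κ, hκ, e, he, hc⟩ := IH (f ∘ a)
    refine ⟨κ, hκ, a ∘ e, he, ?_⟩
    rw [← Nat.card_congr a]
    convert hc using 2
    rw [← RingEquiv.height_comap (renameEquiv k a).toRingEquiv]
    congr 1
    ext p
    simp [RingHom.mem_ker, Ideal.mem_comap, aeval_rename]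
  | h_empty =>
    intro f
    exact ⟨PEmpty, inferInstance, id, algebraicIndependent_empty_type, by simp⟩
  | @h_option σ _ IH =>
    intro f
    obtain ⟨κ, hκ, e, he, hc⟩ := IH (f ∘ some)
    set P' := RingHom.ker (aeval (f ∘ some) : MvPolynomial σ k →ₐ[k] L) with hP'
    have hP'p : P'.IsPrime := RingHom.ker_isPrime _
    set P := RingHom.ker (aeval f : MvPolynomial (Option σ) k →ₐ[k] L) with hP
    have hPp : P.IsPrime := RingHom.ker_isPrime _
    set Q := P.comap (optionEquivLeft k σ).symm.toRingEquiv with hQ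
    have hQp : Q.IsPrime := Ideal.comap_isPrime _ _
    have hQh : Q.height = P.height := RingEquiv.height_comap _ _
    have hle : P'.map Polynomial.C ≤ Q := by
      rw [Ideal.map_le_iff_le_comap]
      intro p hp
      have : ∀ p, (optionEquivLeft k σ).symm (Polynomial.C p) = rename some p := by
        intro p
        induction p using MvPolynomial.induction_on with
        | C a => simp
        | add p q hp hq => simp [hp, hq]
        | mul_X p i hp => simp [hp]
      simp only [hQ, Ideal.mem_comap, hP, RingHom.mem_ker]
      change aeval f ((optionEquivLeft k σ).symm (Polynomial.C p)) = 0
      rw [this, aeval_rename]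
      exact hp
    have hCp : (P'.map Polynomial.C).IsPrime := (Ideal.isPrime_map_C_iff_isPrime P').2 hP'p
    rw [Finite.card_option, ← hQh]
    -- If equality holds, the new value is transcendental over the earlier ones and joins the
    -- independent family. Otherwise `Q` strictly contains the extended prime and the height grows
    -- by one.
    by_cases heq : P'.map Polynomial.C = Q
    · refine ⟨Option κ, inferInstance, Option.map e, ?_, ?_⟩
      · rw [AlgebraicIndependent, injective_iff_map_eq_zero]
        intro p hp
        have h1 : optionEquivLeft k σ (rename (Option.map e) p) ∈ Q := by
          simp only [hQ, Ideal.mem_comap, hP, RingHom.mem_ker]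
          change aeval f ((optionEquivLeft k σ).symm _) = 0
          rw [AlgEquiv.symm_apply_apply, aeval_rename, hp]
        rw [← heq, Ideal.mem_map_C_iff, optionEquivLeft_rename] at h1
        have h2 : optionEquivLeft k κ p = 0 := by
          ext1 n
          have := h1 n
          rw [Polynomial.coeff_map, hP', RingHom.mem_ker] at this
          change aeval _ (rename e _) = 0 at this
          rw [aeval_rename] at this
          rw [Polynomial.coeff_zero]
          exact (injective_iff_map_eq_zero _).1 he _ this
        exact (map_eq_zero_iff _ (optionEquivLeft k κ).injective).1 h2
      · rw [Finite.card_option, ← heq]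
        push_cast
        rw [← add_assoc]
        gcongr
        exact hc.trans (by gcongr; exact Ideal.height_le_height_map_C P')
    · refine ⟨κ, hκ, some ∘ e, he, ?_⟩
      have h1 := Ideal.height_add_one_le_of_lt_of_isPrime (lt_of_le_of_ne hle heq)
      calc ((Nat.card σ + 1 : ℕ) : ℕ∞) = Nat.card σ + 1 := by push_cast; rfl
        _ ≤ (P'.map Polynomial.C).height + Nat.card κ + 1 := by
          gcongr
          exact hc.trans (by gcongr; exact Ideal.height_le_height_map_C P')
        _ = (P'.map Polynomial.C).height + 1 + Nat.card κ := by ring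
        _ ≤ _ := by gcongr

/-- Independent elements of a polynomial ring number at most its transcendence degree, which is the
number of variables. -/
theorem card_le_height_ker_add_card {k : Type} [Field k] {σ τ : Type} [Finite σ] [Finite τ]
    (f : σ → MvPolynomial τ k) :
    (Nat.card σ : ℕ∞) ≤ (RingHom.ker (aeval f : MvPolynomial σ k →ₐ[k] _)).height + Nat.card τ := by
  obtain ⟨κ, hκ, e, he, hc⟩ := exists_algebraicIndependent_card_le_height_add (k := k) σ f
  refine hc.trans ?_
  gcongr
  have := he.lift_cardinalMk_le_trdeg
  rw [trdeg_of_isDomain] at this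
  simp only [Cardinal.lift_id] at this
  rw [← Nat.cast_card, ← Nat.cast_card] at this
  exact_mod_cast this

/-! ### Functions given by polynomials -/

/-- A function that is given by a polynomial. -/
def IsPolyFun {k τ : Type} [CommRing k] (f : (τ → k) → k) : Prop :=
  ∃ p : MvPolynomial τ k, ∀ y, f y = eval y p

namespace IsPolyFun

variable {k τ : Type} [CommRing k] {f g : (τ → k) → k}

theorem const (a : k) : IsPolyFun (fun _ : τ → k => a) := ⟨C a, by simp⟩

theorem coord (i : τ) : IsPolyFun (fun y : τ → k => y i) := ⟨X i, by simp⟩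

theorem add (hf : IsPolyFun f) (hg : IsPolyFun g) : IsPolyFun (fun y => f y + g y) := by
  obtain ⟨p, hp⟩ := hf
  obtain ⟨q, hq⟩ := hg
  exact ⟨p + q, by simp [hp, hq]⟩

theorem mul (hf : IsPolyFun f) (hg : IsPolyFun g) : IsPolyFun (fun y => f y * g y) := by
  obtain ⟨p, hp⟩ := hf
  obtain ⟨q, hq⟩ := hg
  exact ⟨p * q, by simp [hp, hq]⟩

theorem sub (hf : IsPolyFun f) (hg : IsPolyFun g) : IsPolyFun (fun y => f y - g y) := by
  obtain ⟨p, hp⟩ := hf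
  obtain ⟨q, hq⟩ := hg
  exact ⟨p - q, by simp [hp, hq]⟩

theorem sum {ι : Type*} {s : Finset ι} {f : ι → (τ → k) → k} (hf : ∀ i ∈ s, IsPolyFun (f i)) :
    IsPolyFun (fun y => ∑ i ∈ s, f i y) := by
  choose! p hp using hf
  exact ⟨∑ i ∈ s, p i, fun y => by
    rw [map_sum]; exact Finset.sum_congr rfl fun i hi => hp i hi y⟩

theorem prod {ι : Type*} {s : Finset ι} {f : ι → (τ → k) → k} (hf : ∀ i ∈ s, IsPolyFun (f i)) :
    IsPolyFun (fun y => ∏ i ∈ s, f i y) := by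
  choose! p hp using hf
  exact ⟨∏ i ∈ s, p i, fun y => by
    rw [map_prod]; exact Finset.prod_congr rfl fun i hi => hp i hi y⟩

theorem comp_coord {τ' : Type} (hf : IsPolyFun f) (e : τ → τ') :
    IsPolyFun (fun y : τ' → k => f fun s => y (e s)) := by
  obtain ⟨p, hp⟩ := hf
  exact ⟨rename e p, fun y => by beta_reduce; rw [hp, eval_rename]; rfl⟩

theorem matrix_mul {l m n : Type*} [Fintype m] {A : (τ → k) → Matrix l m k}
    {B : (τ → k) → Matrix m n k} (hA : ∀ i j, IsPolyFun fun y => A y i j)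
    (hB : ∀ i j, IsPolyFun fun y => B y i j) (i : l) (j : n) :
    IsPolyFun fun y => (A y * B y) i j := by
  simp only [Matrix.mul_apply]
  exact sum fun m _ => (hA i m).mul (hB m j)

theorem matrix_mulVec {l m : Type*} [Fintype m] {A : (τ → k) → Matrix l m k}
    {v : (τ → k) → m → k} (hA : ∀ i j, IsPolyFun fun y => A y i j)
    (hv : ∀ j, IsPolyFun fun y => v y j) (i : l) :
    IsPolyFun fun y => (A y).mulVec (v y) i := by
  simp only [Matrix.mulVec, dotProduct]
  exact sum fun m _ => (hA i m).mul (hv m)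

theorem matrix_det {m : Type*} [Fintype m] [DecidableEq m] {A : (τ → k) → Matrix m m k}
    (hA : ∀ i j, IsPolyFun fun y => A y i j) : IsPolyFun fun y => (A y).det := by
  simp only [Matrix.det_apply']
  exact sum fun s _ => (const _).mul (prod fun i _ => hA _ _)

theorem matrix_adjugate {m : Type*} [Fintype m] [DecidableEq m] {A : (τ → k) → Matrix m m k}
    (hA : ∀ i j, IsPolyFun fun y => A y i j) (i j : m) :
    IsPolyFun fun y => (A y).adjugate i j := by
  simp only [Matrix.adjugate_apply]
  refine matrix_det fun a b => ?_
  by_cases h : a = j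
  · subst h; simpa using const _
  · simpa [Matrix.updateRow_ne h] using hA a b

end IsPolyFun

end MvPolynomial

/-! ### Codimension of subsets of affine space -/

namespace TwoQuadrics

open MvPolynomial

theorem affineCodim_anti {σ : Type} {S T : Set (σ → ℂ)} (h : S ⊆ T) :
    affineCodim T ≤ affineCodim S :=
  Ideal.height_mono (vanishingIdeal_anti_mono h)

/-- A relation between the components of `F` vanishes on the image of `F`, so the height bound for
relations bounds the codimension. All parameter counts below go through this. -/
theorem le_affineCodim_of_subset_range {σ τ : Type} [Fintype σ] [Fintype τ] {S : Set (σ → ℂ)}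
    (F : (τ → ℂ) → σ → ℂ) (hF : ∀ i, IsPolyFun fun y => F y i) (hS : S ⊆ Set.range F) {k : ℕ}
    (hk : k + Fintype.card τ ≤ Fintype.card σ) : (k : ℕ∞) ≤ affineCodim S := by
  choose f hf using hF
  have hker : RingHom.ker (aeval f : MvPolynomial σ ℂ →ₐ[ℂ] _) ≤ vanishingIdeal ℂ S := by
    intro p hp x hx
    obtain ⟨y, rfl⟩ := hS hx
    have hy : F y = fun i => eval y (f i) := funext fun i => hf i y
    rw [RingHom.mem_ker] at hp
    have := congrArg (eval y) hp
    rw [map_zero, ← coe_aeval_eq_eval] at this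
    rw [hy]
    change aeval y (aeval f p) = 0 at this
    rwa [← AlgHom.comp_apply, comp_aeval] at this
  have h1 := card_le_height_ker_add_card f
  rw [Nat.card_eq_fintype_card, Nat.card_eq_fintype_card] at h1
  refine le_trans ?_ (Ideal.height_mono hker)
  have h2 : ((k + Fintype.card τ : ℕ) : ℕ∞) ≤ Fintype.card σ := by exact_mod_cast hk
  have h3 := h2.trans h1
  push_cast at h3
  exact (ENat.add_le_add_iff_right (ENat.natCast_ne_top _)).1 h3

/-- A prime containing an intersection of two ideals contains one of them. -/
theorem le_affineCodim_union {σ : Type} {S T : Set (σ → ℂ)} {k : ℕ∞} (hS : k ≤ affineCodim S)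
    (hT : k ≤ affineCodim T) : k ≤ affineCodim (S ∪ T) := by
  have hI : vanishingIdeal ℂ S ⊓ vanishingIdeal ℂ T ≤ vanishingIdeal ℂ (S ∪ T) := by
    rintro p ⟨h1, h2⟩ x (hx | hx)
    · exact h1 x hx
    · exact h2 x hx
  refine le_trans ?_ (Ideal.height_mono hI)
  rw [Ideal.height_eq_inf_minimalPrimes]
  refine le_iInf₂ fun P hP => ?_
  have := hP.isPrime
  rcases (Ideal.IsPrime.inf_le this).1 hP.le with h | h
  · exact hS.trans (Ideal.height_mono h)
  · exact hT.trans (Ideal.height_mono h)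

theorem affineCodim_empty {σ : Type} : affineCodim (∅ : Set (σ → ℂ)) = ⊤ := by
  rw [affineCodim, vanishingIdeal_empty, Ideal.height_top]

theorem le_affineCodim_biUnion {σ ι : Type} {s : Set ι} (hs : s.Finite) {T : ι → Set (σ → ℂ)}
    {k : ℕ∞} (h : ∀ i ∈ s, k ≤ affineCodim (T i)) : k ≤ affineCodim (⋃ i ∈ s, T i) := by
  induction s, hs using Set.Finite.induction_on with
  | empty => simp [affineCodim_empty]
  | @insert a s _ _ ih =>
    rw [Set.biUnion_insert]
    exact le_affineCodim_union (h a (Set.mem_insert a s))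
      (ih fun i hi => h i (Set.mem_insert_of_mem a hi))

theorem le_affineCodim_submodule {σ : Type} [Fintype σ] (W : Submodule ℂ (σ → ℂ)) {k : ℕ}
    (hk : k + Module.finrank ℂ W ≤ Fintype.card σ) : (k : ℕ∞) ≤ affineCodim (W : Set (σ → ℂ)) := by
  let b := Module.finBasis ℂ W
  refine le_affineCodim_of_subset_range (τ := Fin (Module.finrank ℂ W))
    (fun y i => ∑ j, y j * (b j : σ → ℂ) i)
    (fun i => .sum fun j _ => (IsPolyFun.coord j).mul (.const _)) ?_ (by simpa using hk)
  intro x hx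
  refine ⟨b.repr ⟨x, hx⟩, ?_⟩
  have h : ((∑ j, b.repr ⟨x, hx⟩ j • b j : W) : σ → ℂ) = x := by rw [b.sum_repr]
  funext i
  refine Eq.trans ?_ (congrFun h i)
  rw [Submodule.coe_sum, Finset.sum_apply]
  rfl

end TwoQuadrics

/-! ### Quadratic forms and symmetric matrices -/

namespace TwoQuadrics

open MvPolynomial

section MatForm

variable {ι : Type}

/-- The quadratic form `∑ S j k x_j x_k` of the matrix `S`. -/
noncomputable def matForm [Fintype ι] (S : Matrix ι ι ℂ) : MvPolynomial ι ℂ := ∑ j, ∑ k, C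
    (S j k) * (X j * X k)

/-- The symmetric matrix of the quadratic form with coefficients `a`. -/
noncomputable def symMat [DecidableEq ι]
    (a : Sym2 ι → ℂ) : Matrix ι ι ℂ := fun j k => if j = k then a s(j, k) else a s(j, k) / 2

theorem symMat_isSymm [DecidableEq ι] (a : Sym2 ι → ℂ) : (symMat a).IsSymm := by
  ext j k
  simp [symMat, Matrix.transpose_apply, eq_comm, Sym2.eq_swap]

theorem symMat_add_swap [DecidableEq ι] (a : Sym2 ι → ℂ) {j k : ι} (h : j ≠ k) :
    symMat a j k + symMat a k j = a s(j, k) := by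
  simp [symMat, h, h.symm, Sym2.eq_swap (a := k)]

theorem sum_sym2_eq_matForm [Fintype ι] [DecidableEq ι] (a : Sym2 ι → ℂ) :
    ∑ s : Sym2 ι, C (a s) * (s.map (X (R := ℂ))).mul = matForm (symMat a) := by
  rw [matForm, ← Fintype.sum_prod_type']
  rw [← Finset.sum_fiberwise (s := Finset.univ) (g := fun p : ι × ι => s(p.1, p.2))]
  refine Finset.sum_congr rfl fun s _ => ?_
  induction s with
  | _ j k =>
    rw [Sym2.map_mk, Sym2.mul_mk]
    by_cases h : j = k
    · subst h
      have : (Finset.univ.filter fun p : ι × ι => s(p.1, p.2) = s(j, j)) = {(j, j)} := by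
        ext ⟨a, b⟩
        simp
      rw [this, Finset.sum_singleton]
      simp [symMat]
    · have : (Finset.univ.filter fun p : ι × ι => s(p.1, p.2) = s(j, k)) = {(j, k), (k, j)} := by
        ext ⟨a, b⟩
        simp
      rw [this, Finset.sum_pair (by simp [h]), ← symMat_add_swap a h, C_add]
      ring

theorem eval_matForm [Fintype ι] (S : Matrix ι ι ℂ) (x : ι → ℂ) : eval x
    (matForm S) = x ⬝ᵥ S.mulVec x := by
  simp only [matForm, map_sum, map_mul, eval_C, eval_X, dotProduct, Matrix.mulVec, Finset.mul_sum]
  exact Finset.sum_congr rfl fun j _ => Finset.sum_congr rfl fun k _ => by ring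

theorem matForm_isHomogeneous [Fintype ι] (S : Matrix ι ι ℂ) : (matForm S).IsHomogeneous 2 :=
  IsHomogeneous.sum _ _ _ fun j _ => IsHomogeneous.sum _ _ _ fun k _ =>
    ((isHomogeneous_X ℂ j).mul (isHomogeneous_X ℂ k)).C_mul _

theorem matForm_comb [Fintype ι] (a b : ℂ) (S T : Matrix ι ι ℂ) :
    matForm (a • S + b • T) = C a * matForm S + C b * matForm T := by
  simp only [matForm, Finset.mul_sum, ← Finset.sum_add_distrib]
  exact Finset.sum_congr rfl fun j _ => Finset.sum_congr rfl fun k _ => by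
    simp only [Matrix.add_apply, Matrix.smul_apply, smul_eq_mul, C_add, C_mul]; ring

theorem eval_pderiv_matForm [Fintype ι] [DecidableEq ι]
    {S : Matrix ι ι ℂ} (hS : S.IsSymm) (x : ι → ℂ) (i : ι) :
    eval x (pderiv i (matForm S)) = 2 * S.mulVec x i := by
  have h : ∀ j k, S j k = S k j := fun j k => congrFun (congrFun hS.symm j) k
  simp only [matForm, map_sum, Derivation.leibniz, pderiv_X, pderiv_C, smul_eq_mul, map_add,
    map_mul, eval_C, eval_X, Pi.single_apply, Matrix.mulVec, dotProduct, mul_zero, add_zero,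
    mul_add, Finset.sum_add_distrib]
  rw [two_mul]
  congr 1
  · rw [Finset.sum_comm]
    simp [apply_ite (eval x), h i]
  · simp [apply_ite (eval x)]

/-- The bilinear form of a symmetric matrix is determined by its quadratic form. -/
theorem two_mul_dotProduct_mulVec [Fintype ι] {S : Matrix ι ι ℂ} (hS : S.IsSymm) (x y : ι → ℂ) :
    2 * (y ⬝ᵥ S.mulVec x) =
      (x + y) ⬝ᵥ S.mulVec (x + y) - x ⬝ᵥ S.mulVec x - y ⬝ᵥ S.mulVec y := by
  have h : x ⬝ᵥ S.mulVec y = y ⬝ᵥ S.mulVec x := by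
    rw [Matrix.dotProduct_mulVec, ← Matrix.mulVec_transpose, hS.eq, dotProduct_comm]
  rw [Matrix.mulVec_add, dotProduct_add, add_dotProduct, add_dotProduct, h]
  ring

/-- A quadratic form that is a product of two linear forms has rank at most two. -/
theorem rank_le_two_of_eq_mul [Fintype ι] [DecidableEq ι] {S : Matrix ι ι ℂ} (hS : S.IsSymm)
    {l m : MvPolynomial ι ℂ}
    (hl : l.IsHomogeneous 1) (hm : m.IsHomogeneous 1) (h : matForm S = l * m) : S.rank ≤ 2 := by
  have lin : ∀ p : MvPolynomial ι ℂ, p.IsHomogeneous 1 → ∃ v : ι → ℂ, ∀ x, eval x p = v ⬝ᵥ x := by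
    intro p hp
    have : p ∈ homogeneousSubmodule ι ℂ 1 := hp
    rw [homogeneousSubmodule_one_eq_span_X, Submodule.mem_span_range_iff_exists_fun] at this
    obtain ⟨v, rfl⟩ := this
    exact ⟨v, fun x => by simp [dotProduct, smul_eval]⟩
  obtain ⟨u, hu⟩ := lin l hl
  obtain ⟨v, hv⟩ := lin m hm
  have key : ∀ x, x ⬝ᵥ S.mulVec x = (u ⬝ᵥ x) * (v ⬝ᵥ x) := fun x => by
    rw [← eval_matForm, h, map_mul, hu, hv]
  -- Polarizing (u·x)(v·x) gives S = (uvᵀ + vuᵀ)/2, which factors through a two-dimensional space.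
  let U : Matrix ι (Fin 2) ℂ := Matrix.of fun i => ![u i / 2, v i / 2]
  let W : Matrix (Fin 2) ι ℂ := Matrix.of ![v, u]
  have hS2 : S = U * W := by
    ext i j
    have h1 := two_mul_dotProduct_mulVec hS (Pi.single j (1 : ℂ)) (Pi.single i 1)
    have h2 := key (Pi.single j 1)
    have h3 := key (Pi.single i 1)
    simp only [key, dotProduct_add, Matrix.mulVec_single_one, single_dotProduct,
      dotProduct_single, Matrix.col_apply] at h1 h2 h3
    simp only [W, U, Matrix.mul_apply, Fin.sum_univ_two, Matrix.of_apply, Matrix.cons_val_zero,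
      Matrix.cons_val_one]
    linear_combination (h1 - h2 - h3) / 2
  rw [hS2]
  exact (Matrix.rank_mul_le_left U W).trans (by simpa using U.rank_le_card_width)

end MatForm

/-! ### Parametrization of symmetric matrices of bounded rank -/

section LowRank

variable {ι : Type}

/-- The coefficients of the quadratic form of a symmetric matrix. -/
noncomputable def coeffs [DecidableEq ι] (S : Matrix ι ι ℂ) (s : Sym2 ι) : ℂ :=
  (if s.out.1 = s.out.2 then 1 else 2) * S s.out.1 s.out.2

theorem coeffs_symMat [DecidableEq ι] (a : Sym2 ι → ℂ) : coeffs (symMat a) = a := by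
  funext s
  have : s(s.out.1, s.out.2) = s := Quot.out_eq s
  rw [coeffs, symMat, this]
  split_ifs <;> ring

theorem isPolyFun_coeffs [DecidableEq ι] {τ : Type} {S : (τ → ℂ) → Matrix ι ι ℂ}
    (hS : ∀ i j, IsPolyFun fun y => S y i j) (s : Sym2 ι) : IsPolyFun fun y => coeffs (S y) s :=
  (IsPolyFun.const _).mul (hS _ _)

/-- The matrix whose columns over `J` are the unit vectors, with free entries elsewhere. -/
noncomputable def echelon [DecidableEq ι] (J : Finset ι) (y : Sym2 J ⊕ J ×
    {i // i ∉ J} → ℂ) : Matrix J ι ℂ :=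
  fun j i => if h : i ∈ J then (if (j : ι) = i then 1 else 0) else y (Sum.inr (j, ⟨i, h⟩))

/-- A parametrization of the symmetric matrices that are pulled back from the coordinates `J`. -/
noncomputable def lowRank [DecidableEq ι] (J : Finset ι) (y : Sym2 J ⊕ J ×
    {i // i ∉ J} → ℂ) : Matrix ι ι ℂ :=
  (echelon J y).transpose * (symMat (fun s => y (Sum.inl s)) * echelon J y)

theorem isPolyFun_symMat [DecidableEq ι]
    (i j : ι) : IsPolyFun fun y : Sym2 ι → ℂ => symMat y i j := by
  unfold symMat
  by_cases h : i = j
  · simpa [h] using IsPolyFun.coord _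
  · simpa [h, div_eq_mul_inv] using (IsPolyFun.coord _).mul (IsPolyFun.const _)

theorem isPolyFun_lowRank [DecidableEq ι] (J : Finset ι)
    (i j : ι) : IsPolyFun fun y => lowRank J y i j := by
  have h1 : ∀ a b, IsPolyFun fun y => echelon J y a b := by
    intro a b
    unfold echelon
    by_cases h : b ∈ J
    · simpa [h] using IsPolyFun.const _
    · simpa [h] using IsPolyFun.coord _
  have h2 : ∀ a b, IsPolyFun fun y : Sym2 J ⊕ J × {i // i ∉ J} → ℂ =>
      symMat (fun s => y (Sum.inl s)) a b := fun a b => (isPolyFun_symMat a b).comp_coord Sum.inl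
  exact IsPolyFun.matrix_mul (fun a b => h1 b a) (IsPolyFun.matrix_mul h2 h1) i j

theorem symMat_coeffs [DecidableEq ι]
    {S : Matrix ι ι ℂ} (hS : S.IsSymm) : symMat (coeffs S) = S := by
  ext i j
  have h : ∀ j k, S j k = S k j := fun j k => congrFun (congrFun hS.symm j) k
  have : s(s(i, j).out.1, s(i, j).out.2) = s(i, j) := Quot.out_eq _
  by_cases hij : i = j
  · subst hij
    rw [symMat, coeffs]
    rcases Sym2.eq_iff.1 this with ⟨h1, h2⟩ | ⟨h1, h2⟩ <;> rw [h1, h2] <;> simp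
  rw [symMat, coeffs, if_neg hij]
  rcases Sym2.eq_iff.1 this with ⟨h1, h2⟩ | ⟨h1, h2⟩
  · rw [h1, h2, if_neg hij]; ring
  · rw [h1, h2, h j i, if_neg (Ne.symm hij)]; ring

/-- Take rows of `S` indexed by `J` that span the row space. With E expressing all rows through
these, S = EᵀR for the block R of the chosen rows. By symmetry R = TE, with T the J×J block, so S =
EᵀTE. -/
theorem exists_eq_lowRank [Fintype ι] [DecidableEq ι] {S : Matrix ι ι ℂ} (hS : S.IsSymm)
    {r : ℕ} (hr : S.rank ≤ r)
    (hrn : r ≤ Fintype.card ι) : ∃ J : Finset ι, J.card = r ∧ ∃ y, S = lowRank J y := by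
  obtain ⟨κ, a, ha, hspan, hli⟩ := exists_linearIndependent' ℂ S.row
  have : Finite κ := Finite.of_injective a ha
  have := Fintype.ofFinite κ
  have hcard : (Finset.univ.image a).card ≤ r := by
    rw [Finset.card_image_of_injective _ ha, Finset.card_univ, ← finrank_span_eq_card hli, hspan,
      ← Matrix.rank_eq_finrank_span_row]
    exact hr
  -- A basis of the row space may have fewer than `r` elements; enlarging it keeps the span and
  -- fixes the parameter count.
  obtain ⟨J, hJ, hJr⟩ := Finset.exists_superset_card_eq hcard hrn
  refine ⟨J, hJr, ?_⟩
  have hrow : ∀ i, ∃ b : J → ℂ, ∑ j, b j • S.row j = S.row i := by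
    intro i
    rw [← Submodule.mem_span_range_iff_exists_fun]
    have h1 : S.row i ∈ Submodule.span ℂ (Set.range (S.row ∘ a)) := by
      rw [hspan]; exact Submodule.subset_span ⟨i, rfl⟩
    refine Submodule.span_mono ?_ h1
    rintro _ ⟨k, rfl⟩
    exact ⟨⟨a k, hJ (Finset.mem_image_of_mem a (Finset.mem_univ k))⟩, rfl⟩
  choose b hb using hrow
  let T : Matrix J J ℂ := fun j l => S j l
  let R : Matrix J ι ℂ := fun j k => S j k
  let y : Sym2 J ⊕ J × {i // i ∉ J} → ℂ := Sum.elim (coeffs T) fun p => b p.2 p.1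
  have hcol : ∀ i k, S i k = ∑ j : J, echelon J y j i * S j k := by
    intro i k
    by_cases h : i ∈ J
    · rw [Finset.sum_eq_single (⟨i, h⟩ : J)]
      · simp [echelon, h]
      · intro j _ hj
        have : (j : ι) ≠ i := fun h' => hj (Subtype.ext h')
        simp [echelon, h, this]
      · simp
    · have := congrFun (hb i) k
      simp only [Finset.sum_apply, Pi.smul_apply, smul_eq_mul, Matrix.row_apply] at this
      rw [← this]
      simp [echelon, h, y]
  have hs : ∀ j k, S j k = S k j := fun j k => congrFun (congrFun hS.symm j) k
  have hT : T.IsSymm := by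
    ext j l
    exact hs _ _
  have hR : R = T * echelon J y := by
    ext j k
    rw [Matrix.mul_apply]
    change S j k = ∑ l : J, S j l * echelon J y l k
    rw [hs, hcol]
    exact Finset.sum_congr rfl fun l _ => by rw [mul_comm, hs]
  refine ⟨y, ?_⟩
  rw [lowRank]
  change S = _ * (symMat (coeffs T) * _)
  rw [symMat_coeffs hT, ← hR]
  ext i k
  rw [Matrix.mul_apply, hcol]
  rfl

theorem card_lowRank_params [Fintype ι] [DecidableEq ι] {J : Finset ι} {r : ℕ} (hJ : J.card = r) :
    Fintype.card (Sym2 J ⊕ J × {i // i ∉ J}) = (r + 1).choose 2 + r * (Fintype.card ι - r) := by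
  rw [Fintype.card_sum, Sym2.card, Fintype.card_prod, Fintype.card_coe, hJ,
    Fintype.card_subtype_compl, Fintype.card_coe, hJ]

end LowRank

end TwoQuadrics

/-! ### Dimension counts for the exceptional pairs -/

namespace TwoQuadrics

open MvPolynomial

section BadPairs

variable {N : ℕ}

/-- The symmetric matrix of the `i`-th form of a pair. -/
noncomputable def pairMat (c : PairSpace N) (i : Fin 2) : Matrix (Fin (N + 1)) (Fin (N + 1)) ℂ :=
  symMat fun s => c (i, s)

theorem pairMat_isSymm (c : PairSpace N) (i : Fin 2) : (pairMat c i).IsSymm := symMat_isSymm _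

theorem quadForm_eq (c : PairSpace N) (i : Fin 2) : quadForm c i = matForm (pairMat c i) :=
  sum_sym2_eq_matForm _

/-- Dimension count for a set of pairs whose matrices are parametrized polynomially. -/
theorem le_affineCodim_of_pairMat {τ : Type} [Fintype τ] {P : Set (PairSpace N)}
    (S : (τ → ℂ) → Fin 2 → Matrix (Fin (N + 1)) (Fin (N + 1)) ℂ)
    (hS : ∀ i j k, IsPolyFun fun y => S y i j k)
    (hP : ∀ c ∈ P, ∃ y, ∀ i, pairMat c i = S y i) {k : ℕ}
    (hk : k + Fintype.card τ ≤ 2 * (N + 2).choose 2) : (k : ℕ∞) ≤ affineCodim P := by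
  refine le_affineCodim_of_subset_range (fun y p => coeffs (S y p.1) p.2)
    (fun p => isPolyFun_coeffs (hS p.1) p.2) ?_ ?_ (k := k)
  · intro c hc
    obtain ⟨y, hy⟩ := hP c hc
    refine ⟨y, ?_⟩
    funext p
    simp only [← hy]
    rw [pairMat, coeffs_symMat]
  · rw [Fintype.card_prod, Sym2.card, Fintype.card_fin, Fintype.card_fin]
    exact hk

/-- The pairs `(g₁, g₂)` such that some `g_i - t g_j` has rank at most 5. -/
theorem le_affineCodim_rank_add_smul (hN : 8 ≤ N) (i j : Fin 2) (hij : i ≠ j) :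
    (((N - 4) * (N - 3) / 2 - 2 : ℕ) : ℕ∞) ≤ affineCodim
      {c : PairSpace N | ∃ t : ℂ, (pairMat c i - t • pairMat c j).rank ≤ 5} := by
  have hsub : {c : PairSpace N | ∃ t : ℂ, (pairMat c i - t • pairMat c j).rank ≤ 5} ⊆
      ⋃ J ∈ {J : Finset (Fin (N + 1)) | J.card = 5},
        {c | ∃ t : ℂ, ∃ y, pairMat c i - t • pairMat c j = lowRank J y} := by
    rintro c ⟨t, ht⟩
    obtain ⟨J, hJ, y, hy⟩ := exists_eq_lowRank
      ((pairMat_isSymm c i).sub ((pairMat_isSymm c j).smul t)) ht (by simp; omega)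
    exact Set.mem_biUnion hJ ⟨t, y, hy⟩
  refine le_trans (le_affineCodim_biUnion (Set.toFinite _) fun J hJ => ?_) (affineCodim_anti hsub)
  refine le_affineCodim_of_pairMat
    -- The parameters are the low-rank matrix, the whole j-th form and the scalar t. They leave
    -- codimension (N-4)(N-3)/2 - 1, one more than required.
    (τ := (Sym2 J ⊕ J × {i // i ∉ J}) ⊕ (Sym2 (Fin (N + 1)) ⊕ Unit))
    (fun y l => if l = i then lowRank J (fun s => y (Sum.inl s)) +
      y (Sum.inr (Sum.inr ())) • symMat (fun s => y (Sum.inr (Sum.inl s)))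
      else symMat (fun s => y (Sum.inr (Sum.inl s)))) ?_ ?_ ?_
  · intro l a b
    by_cases h : l = i
    · simpa [h] using ((isPolyFun_lowRank J a b).comp_coord Sum.inl).add ((IsPolyFun.coord
        (Sum.inr (Sum.inr ()))).mul ((isPolyFun_symMat a b).comp_coord (Sum.inr ∘ Sum.inl)))
    · simpa [h] using (isPolyFun_symMat a b).comp_coord (Sum.inr ∘ Sum.inl)
  · rintro c ⟨t, y, hy⟩
    refine ⟨Sum.elim y (Sum.elim (fun s => c (j, s)) fun _ => t), fun l => ?_⟩
    by_cases h : l = i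
    · subst h
      simp only [if_true, Sum.elim_inl, Sum.elim_inr]
      rw [← hy]
      change _ = _ + t • pairMat c j
      abel
    · have : l = j := by omega
      subst this
      simp only [h, if_false, Sum.elim_inl, Sum.elim_inr]
      rfl
  · rw [Fintype.card_sum, card_lowRank_params hJ, Fintype.card_sum, Sym2.card, Fintype.card_fin,
      Fintype.card_unit]
    obtain ⟨m, rfl⟩ := Nat.exists_eq_add_of_le hN
    have h1 : (8 + m + 1 + 1).choose 2 * 2 = (m + 10) * (m + 9) := by
      rw [Nat.choose_two_right, Nat.div_mul_cancel (Nat.even_mul_pred_self _).two_dvd]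
      congr 1 <;> omega
    have h2 : (5 + 1).choose 2 = 15 := by decide
    have h3 : (8 + m - 4) * (8 + m - 3) = (m + 4) * (m + 5) := by congr 1 <;> omega
    have h4 : (8 + m + 1 - 5) = m + 4 := by omega
    rw [h2, h3, h4]
    change _ ≤ 2 * (8 + m + 1 + 1).choose 2
    ring_nf at h1 ⊢
    omega

/-- The pairs `(g₁, g₂)` of forms of rank at most 6. -/
theorem le_affineCodim_rank_le_six (hN : 8 ≤ N) :
    (((N - 4) * (N - 3) / 2 - 2 : ℕ) : ℕ∞) ≤ affineCodim
      {c : PairSpace N | ∀ i, (pairMat c i).rank ≤ 6} := by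
  have hsub : {c : PairSpace N | ∀ i, (pairMat c i).rank ≤ 6} ⊆
      ⋃ J ∈ {J : Fin 2 → Finset (Fin (N + 1)) | ∀ i, (J i).card = 6},
        {c | ∀ i, ∃ y, pairMat c i = lowRank (J i) y} := by
    intro c hc
    choose J hJ hy using fun i => exists_eq_lowRank (pairMat_isSymm c i) (hc i) (by simp; omega)
    exact Set.mem_biUnion hJ hy
  refine le_trans (le_affineCodim_biUnion (Set.toFinite _) fun J hJ => ?_) (affineCodim_anti hsub)
  refine le_affineCodim_of_pairMat
    (τ := Σ i : Fin 2, (Sym2 (J i) ⊕ (J i) × {l // l ∉ J i}))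
    (fun y i => lowRank (J i) fun s => y ⟨i, s⟩) ?_ ?_ ?_
  · intro i a b
    exact IsPolyFun.comp_coord (f := fun z => lowRank (J i) z a b) (isPolyFun_lowRank (J i) a b)
      (fun s => (⟨i, s⟩ : Σ i : Fin 2, (Sym2 (J i) ⊕ (J i) × {l // l ∉ J i})))
  · intro c hc
    choose y hy using hc
    exact ⟨fun p => y p.1 p.2, hy⟩
  -- Each form contributes codimension (N-5)(N-4)/2. The total (N-5)(N-4) exceeds the required bound
  -- by (N-4)(N-7)/2 + 2.
  · rw [Fintype.card_sigma, Fin.sum_univ_two, card_lowRank_params (hJ 0),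
      card_lowRank_params (hJ 1), Fintype.card_fin]
    obtain ⟨m, rfl⟩ := Nat.exists_eq_add_of_le hN
    have h1 : (8 + m + 1 + 1).choose 2 * 2 = (m + 10) * (m + 9) := by
      rw [Nat.choose_two_right, Nat.div_mul_cancel (Nat.even_mul_pred_self _).two_dvd]
      congr 1 <;> omega
    have h2 : (6 + 1).choose 2 = 21 := by decide
    have h3 : (8 + m - 4) * (8 + m - 3) = (m + 4) * (m + 5) := by congr 1 <;> omega
    have h4 : (8 + m + 1 - 6) = m + 3 := by omega
    rw [h2, h3, h4]
    change _ ≤ 2 * (8 + m + 1 + 1).choose 2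
    ring_nf at h1 ⊢
    omega

end BadPairs

end TwoQuadrics

/-! ### Kernels of the members of a pencil -/

namespace TwoQuadrics

open MvPolynomial

section Pencil

variable {ι : Type}

theorem le_affineCodim_ker [Fintype ι] {M : Matrix ι ι ℂ} {r : ℕ} (h : r ≤ M.rank) :
    (r : ℕ∞) ≤ affineCodim {x : ι → ℂ | M.mulVec x = 0} := by
  refine le_affineCodim_submodule (LinearMap.ker M.mulVecLin) ?_
  have := LinearMap.finrank_range_add_finrank_ker M.mulVecLin
  rw [Module.finrank_fintype_fun_eq_card] at this
  change M.rank + _ = _ at this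
  omega

/-- A matrix `B` of rank at least `s` is injective on some subspace of dimension `s` (the range
of `Q`), with a left inverse `P`, and this subspace has a parametrized complement `R`. -/
theorem exists_mul_mul_eq_one [Fintype ι] [DecidableEq ι] {B : Matrix ι ι ℂ}
    {s : ℕ} (h : s ≤ B.rank) :
    ∃ (P : Matrix (Fin s) ι ℂ) (Q : Matrix ι (Fin s) ℂ)
      (R : Matrix ι (Fin (Fintype.card ι - s)) ℂ), P * (B * Q) = 1 ∧
      ∀ x, ∃ a v, x = Q.mulVec a + R.mulVec v := by
  let w : Fin s → ι → ℂ := fun k =>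
    (Module.finBasis ℂ (LinearMap.range B.mulVecLin) (Fin.castLE h k) : ι → ℂ)
  have hw : LinearIndependent ℂ w := by
    have h1 := (Module.finBasis ℂ (LinearMap.range B.mulVecLin)).linearIndependent.comp
      (Fin.castLE h) (Fin.castLE_injective h)
    exact h1.map' (Submodule.subtype _) (Submodule.ker_subtype _)
  have hu : ∀ k, ∃ u, B.mulVec u = w k := fun k =>
    (Module.finBasis ℂ (LinearMap.range B.mulVecLin) (Fin.castLE h k)).2
  choose u hu using hu
  have huli : LinearIndependent ℂ u := by
    refine LinearIndependent.of_comp B.mulVecLin ?_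
    convert hw using 1
    funext k
    exact hu k
  let Q : Matrix ι (Fin s) ℂ := Matrix.of fun i k => u k i
  have hBQ : ∀ k, (B * Q).col k = w k := by
    intro k
    rw [← hu k]
    ext i
    simp [Matrix.mul_apply, Matrix.mulVec, dotProduct, Q]
  have hinj : Function.Injective (B * Q).mulVec := by
    rw [Matrix.mulVec_injective_iff]
    rw [show (B * Q).col = w from funext hBQ]
    exact hw
  obtain ⟨g, hg⟩ := LinearMap.exists_leftInverse_of_injective (B * Q).mulVecLin
    (LinearMap.ker_eq_bot.2 hinj)
  obtain ⟨W, hW⟩ := Submodule.exists_isCompl (Submodule.span ℂ (Set.range u))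
  have hdim : Module.finrank ℂ W = Fintype.card ι - s := by
    have := Submodule.finrank_add_eq_of_isCompl hW
    rw [finrank_span_eq_card huli, Fintype.card_fin, Module.finrank_fintype_fun_eq_card] at this
    omega
  let b := Module.finBasisOfFinrankEq ℂ W hdim
  refine ⟨LinearMap.toMatrix' g, Q, Matrix.of fun i k => (b k : ι → ℂ) i, ?_, ?_⟩
  · have h2 := congrArg LinearMap.toMatrix' hg
    rw [LinearMap.toMatrix'_comp, LinearMap.toMatrix'_id] at h2
    convert h2
    exact (LinearMap.toMatrix'_toLin' _).symm
  · intro x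
    have hx : x ∈ Submodule.span ℂ (Set.range u) ⊔ W := by rw [hW.sup_eq_top]; trivial
    obtain ⟨y, hy, z, hz, rfl⟩ := Submodule.mem_sup.1 hx
    obtain ⟨a, rfl⟩ := (Submodule.mem_span_range_iff_exists_fun ℂ).1 hy
    refine ⟨a, b.repr ⟨z, hz⟩, ?_⟩
    congr 1
    · ext i
      simp [Matrix.mulVec, dotProduct, Q, mul_comm]
    · have h : ((∑ j, b.repr ⟨z, hz⟩ j • b j : W) : ι → ℂ) = z := by rw [b.sum_repr]
      refine h.symm.trans ?_
      rw [Submodule.coe_sum]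
      ext i
      rw [Finset.sum_apply]
      simp only [Matrix.mulVec, dotProduct, Matrix.of_apply]
      exact Finset.sum_congr rfl fun j _ => mul_comm _ _

/-- The union of the kernels of the members of a pencil. -/
theorem le_affineCodim_pencil_ker [Fintype ι] [DecidableEq ι] {A B : Matrix ι ι ℂ}
    {r : ℕ} (hA : r ≤ A.rank)
    (hmem : ∀ t : ℂ, r ≤ (B + t • A).rank) (hB : r + 1 ≤ B.rank) :
    (r : ℕ∞) ≤ affineCodim {x : ι → ℂ | A.mulVec x = 0 ∨ ∃ t : ℂ, (B + t • A).mulVec x = 0} := by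
  obtain ⟨P, Q, R, hPQ, hQR⟩ := exists_mul_mul_eq_one hB
  let M : ℂ → Matrix ι ι ℂ := fun t => B + t • A
  let K : ℂ → Matrix (Fin (r + 1)) (Fin (r + 1)) ℂ := fun t => P * (M t * Q)
  -- `K 0` is the identity, so det K(t) is a nonzero polynomial in t.
  have hfin : {t : ℂ | (K t).det = 0}.Finite := by
    let p : Polynomial ℂ := (1 + (Polynomial.X : Polynomial ℂ) •
      (P * (A * Q)).map Polynomial.C).det
    have hp : ∀ t, p.eval t = (K t).det := by
      intro t
      have := (Polynomial.evalRingHom t).map_det (1 + (Polynomial.X : Polynomial ℂ) •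
        (P * (A * Q)).map Polynomial.C)
      rw [Polynomial.coe_evalRingHom] at this
      refine this.trans ?_
      congr 1
      have hK : K t = 1 + t • (P * (A * Q)) := by
        simp only [K, M, Matrix.add_mul, Matrix.mul_add, hPQ, Matrix.smul_mul, Matrix.mul_smul]
      rw [hK]
      generalize P * (A * Q) = T
      ext i j
      by_cases hij : i = j <;> simp [hij] <;> ring
    have hp0 : p ≠ 0 := by
      intro h0
      have := hp 0
      simp [h0, K, M, hPQ] at this
    refine (Polynomial.finite_setOfPred_isRoot hp0).subset fun t ht => ?_
    rw [Set.mem_ofPred_eq, Polynomial.IsRoot, hp]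
    exact ht
  -- If x = Qa + Rv is killed by M(t), then K(t)a = -PM(t)Rv, so a is determined by t and v when det
  -- K(t) ≠ 0. Multiplying by the determinant, with the adjugate in place of the inverse, makes this
  -- polynomial.
  let F : (Unit ⊕ Fin (Fintype.card ι - (r + 1)) → ℂ) → ι → ℂ := fun y =>
    (K (y (Sum.inl ()))).det • R.mulVec (fun k => y (Sum.inr k)) -
      Q.mulVec ((K (y (Sum.inl ()))).adjugate.mulVec
        (P.mulVec ((M (y (Sum.inl ()))).mulVec (R.mulVec fun k => y (Sum.inr k)))))
  have hF : ∀ i, IsPolyFun fun y => F y i := by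
    have hc : ∀ {m n : Type} (T : Matrix m n ℂ) i j, IsPolyFun
        fun _ : Unit ⊕ Fin (Fintype.card ι - (r + 1)) → ℂ => T i j := fun T i j => .const _
    have hM : ∀ i j, IsPolyFun
        fun y : Unit ⊕ Fin (Fintype.card ι - (r + 1)) → ℂ => M (y (Sum.inl ())) i j :=
      fun i j => (IsPolyFun.const _).add ((IsPolyFun.coord _).mul (IsPolyFun.const _))
    have hK : ∀ i j, IsPolyFun
        fun y : Unit ⊕ Fin (Fintype.card ι - (r + 1)) → ℂ => K (y (Sum.inl ())) i j :=
      IsPolyFun.matrix_mul (hc P) (IsPolyFun.matrix_mul hM (hc Q))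
    have hR := IsPolyFun.matrix_mulVec (hc R) fun k => IsPolyFun.coord (Sum.inr k)
    intro i
    exact ((IsPolyFun.matrix_det hK).mul (hR i)).sub (IsPolyFun.matrix_mulVec (hc Q)
      (IsPolyFun.matrix_mulVec (IsPolyFun.matrix_adjugate hK) (IsPolyFun.matrix_mulVec (hc P)
        (IsPolyFun.matrix_mulVec hM hR))) i)
  have hsub : {x : ι → ℂ | A.mulVec x = 0 ∨ ∃ t : ℂ, (B + t • A).mulVec x = 0} ⊆
      ({x | A.mulVec x = 0} ∪ ⋃ t ∈ {t : ℂ | (K t).det = 0}, {x | (M t).mulVec x = 0}) ∪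
        Set.range F := by
    rintro x (hx | ⟨t, ht⟩)
    · exact Or.inl (Or.inl hx)
    · by_cases hd : (K t).det = 0
      · exact Or.inl (Or.inr (Set.mem_biUnion (x := t) hd ht))
      · right
        obtain ⟨a, v, rfl⟩ := hQR x
        -- Dividing v by the determinant compensates for the factor introduced in `F`.
        refine ⟨Sum.elim (fun _ => t) ((K t).det⁻¹ • v), ?_⟩
        change (M t).mulVec _ = 0 at ht
        have h1 : P.mulVec ((M t).mulVec (R.mulVec v)) = -(K t).mulVec a := by
          have := congrArg P.mulVec ht
          rw [Matrix.mulVec_add, Matrix.mulVec_add, Matrix.mulVec_zero] at this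
          rw [eq_neg_iff_add_eq_zero, add_comm (P.mulVec _)]
          simpa [K, Matrix.mulVec_mulVec, Matrix.mul_assoc] using this
        simp only [F, Sum.elim_inl, Sum.elim_inr]
        change (K t).det • R.mulVec ((K t).det⁻¹ • v) - Q.mulVec ((K t).adjugate.mulVec
          (P.mulVec ((M t).mulVec (R.mulVec ((K t).det⁻¹ • v))))) = _
        simp only [Matrix.mulVec_smul, h1]
        rw [Matrix.mulVec_neg, Matrix.mulVec_mulVec a, Matrix.adjugate_mul, Matrix.smul_mulVec,
          Matrix.one_mulVec, smul_smul, mul_inv_cancel₀ hd, one_smul, Matrix.mulVec_neg,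
          Matrix.mulVec_smul, smul_neg, smul_smul, inv_mul_cancel₀ hd, one_smul, sub_neg_eq_add,
          add_comm]
  refine le_trans (le_affineCodim_union (le_affineCodim_union (le_affineCodim_ker hA)
    (le_affineCodim_biUnion hfin fun t _ => le_affineCodim_ker (hmem t)))
    (le_affineCodim_of_subset_range F hF subset_rfl ?_)) (affineCodim_anti hsub)
  -- With n coordinates, `F` has 1 + (n - (r + 1)) = n - r parameters; the rank bound keeps the
  -- subtraction exact.
  have : B.rank ≤ Fintype.card ι := B.rank_le_card_width
  simp only [Fintype.card_sum, Fintype.card_unit, Fintype.card_fin]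
  omega

end Pencil

end TwoQuadrics

/-! ### Factorizations modulo a quadratic form -/

section Graded

open MvPolynomial

namespace MvPolynomial

variable {σ k : Type*} [Field k]

theorem homogeneousComponent_mul_of_isHomogeneous {g : MvPolynomial σ k} {d : ℕ}
    (hg : g.IsHomogeneous d) (w : MvPolynomial σ k) (n : ℕ) :
    homogeneousComponent (d + n) (g * w) = g * homogeneousComponent n w := by
  let _ : GradedAlgebra (homogeneousSubmodule σ k) := gradedAlgebra
  have h := DirectSum.coe_decompose_mul_add_of_left_mem (homogeneousSubmodule σ k)
    (a := g) (b := w) (i := d) (j := n) hg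
  have key : ∀ (p : MvPolynomial σ k) (i : ℕ),
      (DirectSum.decompose (homogeneousSubmodule σ k) p i : MvPolynomial σ k) =
        homogeneousComponent i p := fun p i => decomposition.decompose'_apply p i
  rwa [key, key] at h

theorem totalDegree_sub_homogeneousComponent_lt {u : MvPolynomial σ k} (hu : 0 < u.totalDegree) :
    (u - homogeneousComponent u.totalDegree u).totalDegree < u.totalDegree := by
  classical
  rw [totalDegree, Finset.sup_lt_iff hu]
  intro s hs
  rw [mem_support_iff, coeff_sub, coeff_homogeneousComponent] at hs
  by_cases h : s.degree = u.totalDegree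
  · simp [h] at hs
  · simp only [h, if_false, sub_zero] at hs
    exact lt_of_le_of_ne (le_totalDegree (mem_support_iff.2 hs)) h

theorem homogeneousComponent_mul_totalDegree {u v : MvPolynomial σ k} (hu : 0 < u.totalDegree)
    (hv : 0 < v.totalDegree) : homogeneousComponent (u.totalDegree + v.totalDegree) (u * v) =
      homogeneousComponent u.totalDegree u * homogeneousComponent v.totalDegree v := by
  set a := homogeneousComponent u.totalDegree u with ha
  set b := homogeneousComponent v.totalDegree v with hb
  have haH : a.IsHomogeneous u.totalDegree := homogeneousComponent_isHomogeneous _ _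
  have hbH : b.IsHomogeneous v.totalDegree := homogeneousComponent_isHomogeneous _ _
  have h : u * v = a * b + (a * (v - b) + (u - a) * v) := by ring
  have h1 := totalDegree_sub_homogeneousComponent_lt hu
  have h2 := totalDegree_sub_homogeneousComponent_lt hv
  rw [← ha] at h1
  rw [← hb] at h2
  have h3 : (a * (v - b)).totalDegree < u.totalDegree + v.totalDegree :=
    (totalDegree_mul _ _).trans_lt (add_lt_add_of_le_of_lt haH.totalDegree_le h2)
  have h4 : ((u - a) * v).totalDegree < u.totalDegree + v.totalDegree :=
    (totalDegree_mul _ _).trans_lt (by omega)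
  rw [h, map_add, map_add, homogeneousComponent_eq_zero _ _ h3, homogeneousComponent_eq_zero _ _ h4,
    homogeneousComponent_eq_self (haH.mul hbH), add_zero, add_zero]

/-- A factorization of a quadratic form modulo a quadratic form is trivial, or it comes from a
product of two linear forms. -/
theorem trivial_or_exists_eq_mul_of_dvd_sub_mul {g f : MvPolynomial σ k}
    (hg : g.IsHomogeneous 2) (hgp : (Ideal.span {g}).IsPrime) (hf : f.IsHomogeneous 2) (n : ℕ) :
    ∀ u v : MvPolynomial σ k, u.totalDegree + v.totalDegree = n → g ∣ f - u * v →
      (∃ c, g ∣ u - C c) ∨ (∃ c, g ∣ v - C c) ∨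
        ∃ c l m, l.IsHomogeneous 1 ∧ m.IsHomogeneous 1 ∧ f - C c * g = l * m := by
  induction n using Nat.strong_induction_on with
  | _ n ih =>
    intro u v hn h
    rcases Nat.eq_zero_or_pos u.totalDegree with hu | hu
    · exact Or.inl ⟨coeff 0 u, by rw [← totalDegree_eq_zero_iff_eq_C.1 hu, sub_self]; simp⟩
    rcases Nat.eq_zero_or_pos v.totalDegree with hv | hv
    · exact Or.inr (Or.inl ⟨coeff 0 v, by rw [← totalDegree_eq_zero_iff_eq_C.1 hv, sub_self]; simp⟩)
    obtain ⟨w, hw⟩ := h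
    have hc := homogeneousComponent_mul_totalDegree hu hv
    set a := homogeneousComponent u.totalDegree u with ha
    set b := homogeneousComponent v.totalDegree v with hb
    obtain ⟨e, he⟩ : ∃ e, u.totalDegree + v.totalDegree = 2 + e :=
      ⟨u.totalDegree + v.totalDegree - 2, by omega⟩
    have hcomp := congrArg (homogeneousComponent (2 + e)) hw
    rw [homogeneousComponent_mul_of_isHomogeneous hg, map_sub, ← he, hc, he] at hcomp
    -- Both degrees are positive, so e = 0 forces both top components to be linear, and comparison
    -- in degree 2 gives the third alternative.
    rcases Nat.eq_zero_or_pos e with rfl | he0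
    · refine Or.inr (Or.inr ⟨coeff 0 w, a, b, ?_, ?_, ?_⟩)
      · have : u.totalDegree = 1 := by omega
        rw [← this]
        exact homogeneousComponent_isHomogeneous _ _
      · have : v.totalDegree = 1 := by omega
        rw [← this]
        exact homogeneousComponent_isHomogeneous _ _
      · rw [add_zero, homogeneousComponent_eq_self hf, homogeneousComponent_zero] at hcomp
        linear_combination hcomp
    · have hf0 : homogeneousComponent (2 + e) f = 0 := by
        rw [homogeneousComponent_of_mem hf, if_neg (by omega)]
      rw [hf0, zero_sub] at hcomp
      -- Above degree 2 the form f contributes nothing, so the prime g divides a top component.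
      -- Dropping that component lowers the degree and changes its factor only by a multiple of g.
      have hab : a * b ∈ Ideal.span {g} := by
        rw [Ideal.mem_span_singleton]
        exact (dvd_neg).1 ⟨_, hcomp⟩
      rcases hgp.mem_or_mem hab with h | h <;> rw [Ideal.mem_span_singleton] at h
      · have h1 := totalDegree_sub_homogeneousComponent_lt hu
        rw [← ha] at h1
        have h2 : g ∣ f - (u - a) * v := by
          have : f - (u - a) * v = f - u * v + a * v := by ring
          rw [this]
          exact dvd_add ⟨w, hw⟩ (h.mul_right v)
        rcases ih _ (by omega) (u - a) v rfl h2 with ⟨c, hc⟩ | h3 | h3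
        · refine Or.inl ⟨c, ?_⟩
          have : u - C c = u - a - C c + a := by ring
          rw [this]
          exact dvd_add hc h
        · exact Or.inr (Or.inl h3)
        · exact Or.inr (Or.inr h3)
      · have h1 := totalDegree_sub_homogeneousComponent_lt hv
        rw [← hb] at h1
        have h2 : g ∣ f - u * (v - b) := by
          have : f - u * (v - b) = f - u * v + b * u := by ring
          rw [this]
          exact dvd_add ⟨w, hw⟩ (h.mul_right u)
        rcases ih _ (by omega) u (v - b) rfl h2 with h3 | ⟨c, hc⟩ | h3
        · exact Or.inl h3
        · refine Or.inr (Or.inl ⟨c, ?_⟩)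
          have : v - C c = v - b - C c + b := by ring
          rw [this]
          exact dvd_add hc h
        · exact Or.inr (Or.inr h3)

end MvPolynomial

end Graded

/-! ### Nagata's criterion for a linear equation -/

section Factorial

/-- Over a factorial Noetherian domain `D`, the ring `D[X] / (aX + b)` is factorial if `a` is
prime, `(a, b)` is a prime ideal and `a` does not divide `b`. -/
theorem uniqueFactorizationMonoid_quotient_linear {D : Type*} [CommRing D] [IsDomain D]
    [UniqueFactorizationMonoid D] [IsNoetherianRing D] {a b : D} (ha : Prime a)
    (hab : (Ideal.span {a, b}).IsPrime) (hb : ¬ a ∣ b) :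
    UniqueFactorizationMonoid
      (Polynomial D ⧸ Ideal.span {Polynomial.C a * Polynomial.X + Polynomial.C b}) := by
  set g := Polynomial.C a * Polynomial.X + Polynomial.C b with hg
  have hrel : IsRelPrime a b := (ha.irreducible.isRelPrime_iff_not_dvd).2 hb
  have hgp : Prime g := (Polynomial.irreducible_C_mul_X_add_C ha.ne_zero hrel).prime
  have hI : (Ideal.span {g}).IsPrime := (Ideal.span_singleton_prime hgp.ne_zero).2 hgp
  set R := Polynomial D ⧸ Ideal.span {g} with hR
  let π : Polynomial D →+* R := Ideal.Quotient.mk _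
  have hπ : Function.Surjective π := Ideal.Quotient.mk_surjective
  have hπ0 : ∀ p, π p = 0 ↔ g ∣ p := fun p => by
    rw [← Ideal.mem_span_singleton]; exact Ideal.Quotient.eq_zero_iff_mem
  have hπg : π (Polynomial.C a) * π Polynomial.X + π (Polynomial.C b) = 0 := by
    rw [← map_mul, ← map_add, hπ0]
  set x : R := π (Polynomial.C a) with hx
  have hx0 : x ≠ 0 := by
    intro h
    have h1 := Polynomial.natDegree_le_of_dvd ((hπ0 _).1 h) (by simpa using ha.ne_zero)
    rw [hg, Polynomial.natDegree_linear ha.ne_zero, Polynomial.natDegree_C] at h1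
    omega
  have hxp : Prime x := by
    rw [← Ideal.span_singleton_prime hx0]
    have h1 : ((Ideal.span {a, b}).map Polynomial.C).IsPrime :=
      (Ideal.isPrime_map_C_iff_isPrime _).2 hab
    -- Modulo a the equation aX + b becomes b, so (x) is the image of the prime ideal (a, b)D[X].
    have h2 : Ideal.span {x} = ((Ideal.span {a, b}).map Polynomial.C).map π := by
      rw [Ideal.map_span, Ideal.map_span, Set.image_pair, Set.image_pair]
      refine le_antisymm (Ideal.span_mono (by simp [hx])) (Ideal.span_le.2 ?_)
      rintro y (rfl | rfl)
      · exact Ideal.mem_span_singleton_self _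
      · rw [SetLike.mem_coe, Ideal.mem_span_singleton]
        exact ⟨-π Polynomial.X, by linear_combination hπg⟩
    rw [h2]
    refine Ideal.map_isPrime_of_surjective hπ ?_
    rw [Ideal.mk_ker, Ideal.span_le, Set.singleton_subset_iff]
    refine Ideal.add_mem _ (Ideal.mul_mem_right _ _ ?_) ?_ <;>
      exact Ideal.mem_map_of_mem _ (Ideal.subset_span (by simp))
  let L := Localization.Away a
  have hpow : Submonoid.powers a ≤ nonZeroDivisors D := powers_le_nonZeroDivisors_of_noZeroDivisors
    ha.ne_zero
  have : IsDomain L := IsLocalization.isDomain_localization hpow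
  have hinj : Function.Injective (algebraMap D L) := IsLocalization.injective L hpow
  -- Inverting a solves the equation as X = -b/a, so the localization of `R` at `x` is D[1/a], which
  -- is factorial.
  let θ : Polynomial D →+* L := Polynomial.eval₂RingHom (algebraMap D L)
    (-(algebraMap D L b * IsLocalization.Away.invSelf a))
  have hθC : ∀ d, θ (Polynomial.C d) = algebraMap D L d := fun d => by simp [θ]
  have hθg : ∀ p ∈ Ideal.span {g}, θ p = 0 := by
    intro p hp
    obtain ⟨q, rfl⟩ := Ideal.mem_span_singleton.1 hp
    rw [map_mul]
    have h1 : algebraMap D L a * IsLocalization.Away.invSelf a = 1 :=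
      IsLocalization.Away.mul_invSelf a
    have : θ g = 0 := by
      simp only [θ, hg, map_add, map_mul, Polynomial.coe_eval₂RingHom, Polynomial.eval₂_C,
        Polynomial.eval₂_X]
      linear_combination -(algebraMap D L b) * h1
    rw [this, zero_mul]
  let Θ : R →+* L := Ideal.Quotient.lift _ θ hθg
  have hΘ : ∀ p, Θ (π p) = θ p := fun p => Ideal.Quotient.lift_mk _ _ _
  let _ : Algebra R L := Θ.toAlgebra
  -- Powers of a clear X modulo g. Hence an element killed by `Θ` is killed by a power of `x`.
  have hred : ∀ p : Polynomial D, ∃ (n : ℕ) (d : D),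
      g ∣ Polynomial.C a ^ n * p - Polynomial.C d := by
    intro p
    induction p using Polynomial.induction_on' with
    | add p q hp hq =>
      obtain ⟨n, d, hn⟩ := hp
      obtain ⟨m, e, hm⟩ := hq
      refine ⟨n + m, a ^ m * d + a ^ n * e, ?_⟩
      have : Polynomial.C a ^ (n + m) * (p + q) - Polynomial.C (a ^ m * d + a ^ n * e) =
          Polynomial.C a ^ m * (Polynomial.C a ^ n * p - Polynomial.C d) +
          Polynomial.C a ^ n * (Polynomial.C a ^ m * q - Polynomial.C e) := by
        simp only [map_add, map_mul, map_pow]; ring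
      rw [this]
      exact dvd_add (hn.mul_left _) (hm.mul_left _)
    | monomial n r =>
      refine ⟨n, r * (-b) ^ n, ?_⟩
      have : Polynomial.C a ^ n * Polynomial.monomial n r - Polynomial.C (r * (-b) ^ n) =
          Polynomial.C r * ((Polynomial.C a * Polynomial.X) ^ n - (-Polynomial.C b) ^ n) := by
        rw [← Polynomial.C_mul_X_pow_eq_monomial]
        simp only [map_mul, map_pow, map_neg]; ring
      rw [this]
      refine Dvd.dvd.mul_left ?_ _
      have := sub_dvd_pow_sub_pow (Polynomial.C a * Polynomial.X) (-Polynomial.C b) n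
      rwa [sub_neg_eq_add] at this
  have hloc : IsLocalization.Away x L := by
    refine IsLocalization.Away.mk x ?_ ?_ ?_
    · change IsUnit (Θ (π (Polynomial.C a)))
      rw [hΘ, hθC]
      exact IsLocalization.Away.algebraMap_isUnit a
    · intro s
      obtain ⟨n, d, h⟩ := IsLocalization.Away.surj a s
      refine ⟨n, π (Polynomial.C d), ?_⟩
      change s * Θ (π (Polynomial.C a)) ^ n = Θ (π (Polynomial.C d))
      rw [hΘ, hΘ, hθC, hθC, h]
    · intro r s hrs
      change Θ r = Θ s at hrs
      obtain ⟨p, hp⟩ := hπ (r - s)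
      obtain ⟨n, d, hd⟩ := hred p
      have h1 : π (Polynomial.C a) ^ n * π p = π (Polynomial.C d) := by
        rw [← sub_eq_zero, ← map_pow, ← map_mul, ← map_sub, hπ0]
        exact hd
      have h2 : Θ (π p) = 0 := by rw [hp, map_sub, hrs, sub_self]
      have h3 := congrArg Θ h1
      rw [map_mul, h2, mul_zero, hΘ, hθC] at h3
      have h4 : d = 0 := hinj (by rw [← h3, map_zero])
      rw [h4, map_zero, map_zero, hp] at h1
      exact ⟨n, by linear_combination h1⟩
  have : UniqueFactorizationMonoid L := inferInstance
  exact (UniqueFactorizationMonoid.iff_of_isLocalizationAway_of_prime hxp L).2 this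

end Factorial

/-! ### Factorial quadrics and primality of the ideal of a pair -/

namespace TwoQuadrics

open MvPolynomial

section Coordinates

variable {ι κ : Type}

/-- Pulling back polynomials along a linear map. -/
noncomputable def pullback [Fintype ι] [DecidableEq ι] (e : (ι → ℂ) →ₗ[ℂ] (κ → ℂ)) :
    MvPolynomial κ ℂ →ₐ[ℂ] MvPolynomial ι ℂ :=
  aeval fun k => ∑ i, C (LinearMap.toMatrix' e k i) * X i

theorem eval_pullback [Fintype ι] [DecidableEq ι] (e : (ι → ℂ) →ₗ[ℂ] (κ → ℂ))
    (p : MvPolynomial κ ℂ) (x : ι → ℂ) :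
    eval x (pullback e p) = eval (e x) p := by
  rw [pullback, ← coe_aeval_eq_eval, ← coe_aeval_eq_eval]
  change aeval x (aeval _ p) = aeval _ p
  rw [← AlgHom.comp_apply, comp_aeval]
  congr 2
  funext k
  rw [← LinearMap.toMatrix'_mulVec e x]
  simp [Matrix.mulVec, dotProduct]

/-- The pullback along a linear equivalence is an isomorphism of rings. -/
noncomputable def pullbackEquiv [Fintype ι] [Fintype κ] [DecidableEq ι] [DecidableEq κ] (e :
    (ι → ℂ) ≃ₗ[ℂ] (κ → ℂ)) :
    MvPolynomial κ ℂ ≃ₐ[ℂ] MvPolynomial ι ℂ :=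
  AlgEquiv.ofAlgHom (pullback e) (pullback e.symm)
    (AlgHom.ext fun p => MvPolynomial.funext fun x => by simp [eval_pullback])
    (AlgHom.ext fun p => MvPolynomial.funext fun x => by simp [eval_pullback])

theorem nonempty_quotient_equiv [Fintype ι] [Fintype κ] [DecidableEq ι] [DecidableEq κ] (e :
    (ι → ℂ) ≃ₗ[ℂ] (κ → ℂ)) {p : MvPolynomial ι ℂ}
    {q : MvPolynomial κ ℂ} (h : ∀ x, eval x p = eval (e x) q) :
    Nonempty ((MvPolynomial κ ℂ ⧸ Ideal.span {q}) ≃+* (MvPolynomial ι ℂ ⧸ Ideal.span {p})) := by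
  have hp : pullback e q = p := MvPolynomial.funext fun x => by rw [eval_pullback, h]; rfl
  refine ⟨Ideal.quotientEquiv _ _ (pullbackEquiv e).toRingEquiv ?_⟩
  rw [Ideal.map_span, Set.image_singleton]
  congr 2
  exact hp.symm

/-- The ring of a quadric is factorial in hyperbolic coordinates. -/
theorem uniqueFactorizationMonoid_hyperbolic [Fintype κ] [DecidableEq κ] (j : κ)
    {b : MvPolynomial κ ℂ} (hb : Prime b)
    (hbj : aeval (fun k => if k = j then 0 else X k) b = b) :
    UniqueFactorizationMonoid (MvPolynomial (Option κ) ℂ ⧸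
      Ideal.span {X none * X (some j) + rename some b}) := by
  let s : MvPolynomial κ ℂ →ₐ[ℂ] MvPolynomial κ ℂ := aeval (fun k => if k = j then 0 else X k)
  have hsj : s (X j) = 0 := by simp [s]
  have hs : ∀ p, X j ∣ p - s p := by
    intro p
    induction p using MvPolynomial.induction_on with
    | C a => simp [s]
    | add p q hp hq =>
      rw [map_add, add_sub_add_comm]
      exact dvd_add hp hq
    | mul_X p i hp =>
      rw [map_mul]
      by_cases hi : i = j
      · subst hi
        rw [hsj, mul_zero, sub_zero]
        exact dvd_mul_left _ _
      · have : s (X i) = X i := by simp [s, hi]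
        rw [this, ← sub_mul]
        exact hp.mul_right _
  have hXb : ¬ X j ∣ b := by
    rintro ⟨q, hq⟩
    apply hb.ne_zero
    rw [← hbj]
    change s b = 0
    rw [hq, map_mul, hsj, zero_mul]
  have hX : Prime (X j : MvPolynomial κ ℂ) := X_prime
  have hab : (Ideal.span {X j, b}).IsPrime := by
    have h1 : (Ideal.span {b}).IsPrime := (Ideal.span_singleton_prime hb.ne_zero).2 hb
    -- The substitution X_j = 0 fixes b, so (X_j, b) is the preimage of the prime (b).
    have h2 : Ideal.span {X j, b} = (Ideal.span {b}).comap s := by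
      refine le_antisymm (Ideal.span_le.2 ?_) fun p hp => ?_
      · rintro p (rfl | rfl)
        · rw [SetLike.mem_coe, Ideal.mem_comap, hsj]
          exact zero_mem _
        · rw [SetLike.mem_coe, Ideal.mem_comap]
          change aeval _ p ∈ _
          rw [hbj]
          exact Ideal.mem_span_singleton_self _
      · have h3 : p = (p - s p) + s p := by ring
        rw [h3]
        refine Ideal.add_mem _ (Ideal.span_mono (s := {X j}) (by simp) ?_)
          (Ideal.span_mono (s := {b}) (by simp) hp)
        exact Ideal.mem_span_singleton.2 (hs p)
    rw [h2]
    exact Ideal.comap_isPrime _ _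
  have hU := uniqueFactorizationMonoid_quotient_linear hX hab hXb
  have hr : ∀ p : MvPolynomial κ ℂ, optionEquivLeft ℂ κ (rename some p) = Polynomial.C p := by
    intro p
    induction p using MvPolynomial.induction_on with
    | C a => simp
    | add p q hp hq => simp [hp, hq]
    | mul_X p i hp => simp [hp]
  have e := Ideal.quotientEquiv (Ideal.span {X none * X (some j) + rename some b})
    (Ideal.span {Polynomial.C (X j) * Polynomial.X + Polynomial.C b})
    (optionEquivLeft ℂ κ).toRingEquiv (by
      rw [Ideal.map_span, Set.image_singleton]
      congr 2
      change _ = optionEquivLeft ℂ κ _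
      rw [map_add, map_mul, hr, optionEquivLeft_X_none, optionEquivLeft_X_some, mul_comm])
  exact e.toMulEquiv.symm.uniqueFactorizationMonoid hU

/-- This is the factorization lemma modulo g = 0: a proper factorization would yield two linear
factors and rank at most 2. -/
theorem irreducible_matForm [Fintype ι] [DecidableEq ι]
    {S : Matrix ι ι ℂ} (hS : S.IsSymm) (hr : 3 ≤ S.rank) :
    Irreducible (matForm S) := by
  have hmul : ∀ l m : MvPolynomial ι ℂ, l.IsHomogeneous 1 → m.IsHomogeneous 1 →
      matForm S ≠ l * m := fun l m hl hm h => by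
    have := rank_le_two_of_eq_mul hS hl hm h
    omega
  have h0 : matForm S ≠ 0 := fun h => hmul 0 0 (isHomogeneous_zero _ _ _)
    (isHomogeneous_zero _ _ _) (by rw [h, zero_mul])
  refine ⟨fun h => ?_, fun u v huv => ?_⟩
  · have := h.map (eval (0 : ι → ℂ))
    rw [eval_matForm, zero_dotProduct] at this
    exact not_isUnit_zero this
  · have key := trivial_or_exists_eq_mul_of_dvd_sub_mul (isHomogeneous_zero ι ℂ 2)
      (by rw [Ideal.span_singleton_zero]; exact Ideal.isPrime_bot)
      (matForm_isHomogeneous S) _ u v rfl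
      (by rw [huv, sub_self])
    rcases key with ⟨c, hc⟩ | ⟨c, hc⟩ | ⟨c, l, m, hl, hm, h⟩
    · left
      rw [zero_dvd_iff, sub_eq_zero] at hc
      rw [hc]
      refine (IsUnit.mk0 c fun hc0 => h0 ?_).map C
      rw [huv, hc, hc0, C_0, zero_mul]
    · right
      rw [zero_dvd_iff, sub_eq_zero] at hc
      rw [hc]
      refine (IsUnit.mk0 c fun hc0 => h0 ?_).map C
      rw [huv, hc, hc0, C_0, mul_zero]
    · exact absurd (by simpa using h) (hmul l m hl hm)

theorem matForm_diagonal [Fintype κ] [DecidableEq κ] (w : κ → ℂ) : matForm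
    (Matrix.diagonal w) = ∑ k, C (w k) * (X k * X k) := by
  rw [matForm]
  refine Finset.sum_congr rfl fun j _ => ?_
  rw [Finset.sum_eq_single j]
  · simp
  · intro k _ hk
    simp [Matrix.diagonal_apply_ne' _ hk]
  · simp

theorem rank_diagonal_eq [Fintype κ] [DecidableEq κ] (w : κ → ℂ) :
    (Matrix.diagonal w).rank = (Finset.univ.filter fun k => w k ≠ 0).card := by
  rw [Matrix.rank_diagonal, Fintype.card_subtype]

/-- With α² = w_i and β² = -w_j, two of the squares combine to (αx_i + βx_j)(αx_i - βx_j). These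
factors become the coordinates `none` and `some j'`; the remaining form has rank at least 3, hence
is irreducible. -/
theorem uniqueFactorizationMonoid_diagonal [Fintype ι] [DecidableEq ι]
    {w : ι → ℂ} (hw : 5 ≤ (Matrix.diagonal w).rank) :
    UniqueFactorizationMonoid (MvPolynomial ι ℂ ⧸ Ideal.span {matForm (Matrix.diagonal w)}) := by
  rw [rank_diagonal_eq] at hw
  obtain ⟨i, hi, j, hj, hij⟩ := Finset.one_lt_card.1 (by omega :
    1 < (Finset.univ.filter fun k => w k ≠ 0).card)
  simp only [Finset.mem_filter, Finset.mem_univ, true_and] at hi hj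
  obtain ⟨α, hα⟩ := IsAlgClosed.exists_eq_mul_self (w i)
  obtain ⟨β, hβ⟩ := IsAlgClosed.exists_eq_mul_self (-w j)
  have hα0 : α ≠ 0 := fun h => hi (by rw [hα, h, zero_mul])
  have hβ0 : β ≠ 0 := fun h => hj (by rw [← neg_eq_zero, hβ, h, zero_mul])
  let j' : {k // k ≠ i} := ⟨j, hij.symm⟩
  let w' : {k // k ≠ i} → ℂ := fun k => if k = j' then 0 else w k
  let f : (ι → ℂ) →ₗ[ℂ] (Option {k // k ≠ i} → ℂ) :=
    { toFun := fun x o => o.elim (α * x i + β * x j)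
        fun k => if k = j' then α * x i - β * x j else x k
      map_add' := fun x y => by
        funext o
        cases o with
        | none => simp; ring
        | some k => by_cases hk : k = j' <;> simp [hk]; ring
      map_smul' := fun a x => by
        funext o
        cases o with
        | none => simp; ring
        | some k => by_cases hk : k = j' <;> simp [hk]; ring }
  have hf : Function.Injective f := by
    rw [injective_iff_map_eq_zero]
    intro x hx
    have h1 : α * x i + β * x j = 0 := congrFun hx none
    have h2 : α * x i - β * x j = 0 := by simpa [f] using congrFun hx (some j')
    have h3 : x i = 0 := by
      have : α * x i = 0 := by linear_combination (h1 + h2) / 2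
      exact (mul_eq_zero.1 this).resolve_left hα0
    have h4 : x j = 0 := by
      have : β * x j = 0 := by linear_combination (h1 - h2) / 2
      exact (mul_eq_zero.1 this).resolve_left hβ0
    funext k
    by_cases hki : k = i
    · rw [hki, h3]; rfl
    by_cases hkj : k = j
    · rw [hkj, h4]; rfl
    have h5 := congrFun hx (some ⟨k, hki⟩)
    simpa [f, j', hkj] using h5
  have hcard : Fintype.card ι = Fintype.card (Option {k // k ≠ i}) :=
    Fintype.card_congr (Equiv.optionSubtypeNe i).symm
  let e := LinearMap.linearEquivOfInjective f hf (by
    rw [Module.finrank_fintype_fun_eq_card, Module.finrank_fintype_fun_eq_card, hcard])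
  have hw' : 3 ≤ (Matrix.diagonal w').rank := by
    rw [rank_diagonal_eq]
    have hsub : (Finset.univ.filter fun k => w k ≠ 0) ⊆
        insert i (insert j ((Finset.univ.filter fun k => w' k ≠ 0).image Subtype.val)) := by
      intro k hk
      simp only [Finset.mem_filter, Finset.mem_univ, true_and] at hk
      simp only [Finset.mem_insert, Finset.mem_image, Finset.mem_filter, Finset.mem_univ, true_and]
      by_cases hki : k = i
      · exact Or.inl hki
      by_cases hkj : k = j
      · exact Or.inr (Or.inl hkj)
      exact Or.inr (Or.inr ⟨⟨k, hki⟩, by simpa [w', j', hkj] using hk, rfl⟩)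
    have h1 := Finset.card_le_card hsub
    have h2 := Finset.card_insert_le i
      (insert j ((Finset.univ.filter fun k => w' k ≠ 0).image Subtype.val))
    have h3 := Finset.card_insert_le j ((Finset.univ.filter fun k => w' k ≠ 0).image Subtype.val)
    have h4 : ((Finset.univ.filter fun k => w' k ≠ 0).image Subtype.val).card ≤ _ :=
      Finset.card_image_le
    omega
  have hb : Prime (matForm (Matrix.diagonal w')) :=
    (irreducible_matForm (Matrix.isSymm_diagonal w') hw').prime
  have hU := uniqueFactorizationMonoid_hyperbolic j' hb (by
    rw [matForm_diagonal, map_sum]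
    refine Finset.sum_congr rfl fun k _ => ?_
    by_cases hk : k = j' <;> simp [w', hk])
  obtain ⟨E⟩ := nonempty_quotient_equiv e (p := matForm (Matrix.diagonal w))
    (q := X none * X (some j') + rename some (matForm (Matrix.diagonal w'))) (by
      intro x
      have he : (e x : Option {k // k ≠ i} → ℂ) = f x := rfl
      rw [he, map_add, map_mul, eval_X, eval_X, eval_rename, matForm_diagonal, matForm_diagonal,
        map_sum, map_sum]
      have hn : f x none = α * x i + β * x j := rfl
      have hj2 : f x (some j') = α * x i - β * x j := by simp [f]
      rw [hn, hj2, ← Finset.add_sum_erase _ _ (Finset.mem_univ i)]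
      have h1 : ∑ k ∈ Finset.univ.erase i, eval x (C (w k) * (X k * X k)) =
          ∑ k : {k // k ≠ i}, w k * (x k * x k) := by
        simp only [map_mul, eval_C, eval_X]
        exact (Finset.sum_subtype (Finset.univ.erase i) (by simp) fun k => w k * (x k * x k))
      rw [h1, ← Finset.add_sum_erase _ _ (Finset.mem_univ j'),
        ← Finset.add_sum_erase (a := j') Finset.univ _ (Finset.mem_univ j')]
      have h2 : ∀ k ∈ Finset.univ.erase j', eval (f x ∘ some) (C (w' k) * (X k * X k)) =
          w k * (x k * x k) := by
        intro k hk
        have hk' : k ≠ j' := Finset.ne_of_mem_erase hk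
        simp [w', f, hk']
      rw [Finset.sum_congr rfl h2]
      simp only [map_mul, eval_C, eval_X, w', if_true, zero_mul, j']
      linear_combination (x i * x i) * hα - (x j * x j) * hβ)
  exact E.toMulEquiv.uniqueFactorizationMonoid hU

/-- The homogeneous coordinate ring of a quadric of rank at least 5 is factorial. -/
theorem uniqueFactorizationMonoid_quadric [Fintype ι] [DecidableEq ι]
    {S : Matrix ι ι ℂ} (hS : S.IsSymm) (hr : 5 ≤ S.rank) :
    UniqueFactorizationMonoid (MvPolynomial ι ℂ ⧸ Ideal.span {matForm S}) := by
  let Q : QuadraticForm ℂ (ι → ℂ) := (Matrix.toBilin' S).toQuadraticMap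
  have hQ : ∀ x, Q x = x ⬝ᵥ S.mulVec x := fun x => by
    simp [Q, Matrix.toBilin'_apply']
  obtain ⟨w, ⟨e⟩⟩ := Q.equivalent_weightedSumSquares
  have h1 : ∀ x, eval x (matForm S) = eval (e.toLinearEquiv x) (matForm (Matrix.diagonal w)) := by
    intro x
    rw [eval_matForm, ← hQ, ← e.map_app x, QuadraticMap.weightedSumSquares_apply, matForm_diagonal,
      map_sum]
    exact Finset.sum_congr rfl fun k _ => by simp
  have hrank : 5 ≤ (Matrix.diagonal w).rank := by
    let E := LinearMap.toMatrix' e.toLinearEquiv.toLinearMap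
    have hE : ∀ x, E.mulVec x = e.toLinearEquiv x := fun x => LinearMap.toMatrix'_mulVec _ x
    -- Both sides are symmetric with the same quadratic form; congruence then carries the rank bound
    -- to the diagonal form.
    have hSE : S = E.transpose * (Matrix.diagonal w * E) := by
      have hT : (E.transpose * (Matrix.diagonal w * E)).IsSymm := by
        rw [Matrix.IsSymm, Matrix.transpose_mul, Matrix.transpose_mul, Matrix.transpose_transpose,
          Matrix.diagonal_transpose, Matrix.mul_assoc]
      have hq : ∀ x, x ⬝ᵥ S.mulVec x = x ⬝ᵥ (E.transpose * (Matrix.diagonal w * E)).mulVec x := by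
        intro x
        rw [← eval_matForm, h1, eval_matForm, ← hE, ← Matrix.mulVec_mulVec,
          ← Matrix.mulVec_mulVec, Matrix.dotProduct_mulVec x, Matrix.vecMul_transpose]
      ext a b
      have h2 := two_mul_dotProduct_mulVec hS (Pi.single b (1 : ℂ)) (Pi.single a 1)
      have h3 := two_mul_dotProduct_mulVec hT (Pi.single b (1 : ℂ)) (Pi.single a 1)
      rw [hq, hq, hq, ← h3] at h2
      simpa using h2
    rw [hSE] at hr
    exact hr.trans ((Matrix.rank_mul_le_right _ _).trans (Matrix.rank_mul_le_left _ _))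
  obtain ⟨E⟩ := nonempty_quotient_equiv e.toLinearEquiv h1
  exact E.toMulEquiv.uniqueFactorizationMonoid (uniqueFactorizationMonoid_diagonal hrank)

/-- By degrees the quotient could be replaced by its constant term c, and the form of T - cS would
vanish. -/
theorem not_dvd_matForm [Fintype ι] [DecidableEq ι]
    {S T : Matrix ι ι ℂ} (hS : S.IsSymm) (hT : T.IsSymm)
    (hmem : ∀ t : ℂ, 3 ≤ (T + t • S).rank) : ¬ matForm S ∣ matForm T := by
  rintro ⟨q, hq⟩
  have h1 := homogeneousComponent_mul_of_isHomogeneous (matForm_isHomogeneous S) q 0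
  rw [← hq, add_zero, homogeneousComponent_eq_self (matForm_isHomogeneous T),
    homogeneousComponent_zero] at h1
  have h2 := matForm_comb 1 (-coeff 0 q) T S
  rw [one_smul, C_1, one_mul, C_neg, h1] at h2
  exact (irreducible_matForm (hT.add (hS.smul _)) (hmem (-coeff 0 q))).ne_zero
    (h2.trans (by ring))

/-- Two quadratic forms generate a prime ideal if all members of their pencil have large rank. -/
theorem isPrime_span_pair [Fintype ι] [DecidableEq ι]
    {S T : Matrix ι ι ℂ} (hS : S.IsSymm) (hT : T.IsSymm)
    (hSr : 5 ≤ S.rank) (hmem : ∀ t : ℂ, 3 ≤ (T + t • S).rank) :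
    (Ideal.span {matForm S, matForm T}).IsPrime := by
  have hU := uniqueFactorizationMonoid_quadric hS hSr
  have hSp : Prime (matForm S) := (irreducible_matForm hS (by omega)).prime
  have hSI : (Ideal.span {matForm S}).IsPrime := (Ideal.span_singleton_prime hSp.ne_zero).2 hSp
  let π := Ideal.Quotient.mk (Ideal.span {matForm S})
  have hπ : Function.Surjective π := Ideal.Quotient.mk_surjective
  have hπ0 : ∀ p, π p = 0 ↔ matForm S ∣ p := fun p => by
    rw [← Ideal.mem_span_singleton]; exact Ideal.Quotient.eq_zero_iff_mem
  have hcomb : ∀ (c : ℂ) (l m : MvPolynomial ι ℂ), l.IsHomogeneous 1 → m.IsHomogeneous 1 →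
      matForm T - C c * matForm S ≠ l * m := by
    intro c l m hl hm h
    have h1 : matForm (T + (-c) • S) = l * m := by
      rw [← h]
      have := matForm_comb 1 (-c) T S
      rw [one_smul] at this
      rw [this, C_1, one_mul, C_neg]
      ring
    have h2 := rank_le_two_of_eq_mul (hT.add (hS.smul (-c))) hl hm h1
    have := hmem (-c)
    omega
  have hT0 : π (matForm T) ≠ 0 := fun h => not_dvd_matForm hS hT hmem ((hπ0 _).1 h)
  have hconst : ∀ (c : ℂ) (u : MvPolynomial ι ℂ), matForm S ∣ u - C c → π u = π (C c) := by
    intro c u h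
    rw [← sub_eq_zero, ← map_sub, hπ0]
    exact h
  have hirr : Irreducible (π (matForm T)) := by
    refine ⟨fun h => ?_, fun u v huv => ?_⟩
    · obtain ⟨q, hq⟩ := h.exists_right_inv
      obtain ⟨q, rfl⟩ := hπ q
      rw [← map_mul, ← sub_eq_zero, ← map_one π, ← map_sub, hπ0] at hq
      obtain ⟨r, hr⟩ := hq
      have := congrArg (eval (0 : ι → ℂ)) hr
      rw [map_sub, map_mul, map_mul, eval_matForm, eval_matForm, zero_dotProduct, zero_dotProduct,
        map_one] at this
      simp at this
    · obtain ⟨u, rfl⟩ := hπ u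
      obtain ⟨v, rfl⟩ := hπ v
      have hdvd : matForm S ∣ matForm T - u * v := by
        rw [← hπ0, map_sub, map_mul, huv, sub_self]
      rcases trivial_or_exists_eq_mul_of_dvd_sub_mul (matForm_isHomogeneous S) hSI
        (matForm_isHomogeneous T) _ u v rfl hdvd with ⟨c, hc⟩ | ⟨c, hc⟩ | ⟨c, l, m, hl, hm, h⟩
      · left
        rw [hconst c u hc]
        refine ((IsUnit.mk0 c fun hc0 => hT0 ?_).map C).map π
        rw [huv, hconst c u hc, hc0, C_0, map_zero, zero_mul]
      · right
        rw [hconst c v hc]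
        refine ((IsUnit.mk0 c fun hc0 => hT0 ?_).map C).map π
        rw [huv, hconst c v hc, hc0, C_0, map_zero, mul_zero]
      · exact absurd h (hcomb c l m hl hm)
  have hp : (Ideal.span {π (matForm T)}).IsPrime :=
    (Ideal.span_singleton_prime hT0).2 hirr.prime
  have hcm : Ideal.span {matForm S, matForm T} = (Ideal.span {π (matForm T)}).comap π := by
    rw [show ({π (matForm T)} : Set _) = π '' {matForm T} from Set.image_singleton.symm,
      ← Ideal.map_span, Ideal.comap_map_of_surjective π hπ,
      ← RingHom.ker_eq_comap_bot, Ideal.mk_ker, Ideal.span_insert, sup_comm]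
  rw [hcm]
  exact Ideal.comap_isPrime _ _

end Coordinates

end TwoQuadrics

/-! ### Criterion for a pair to be regular -/

namespace TwoQuadrics

open MvPolynomial

section Regular

variable {N : ℕ} {S T : Matrix (Fin (N + 1)) (Fin (N + 1)) ℂ}

theorem eval_smul_matForm (S : Matrix (Fin (N + 1)) (Fin (N + 1)) ℂ) (a : ℂ)
    (x : Fin (N + 1) → ℂ) : eval (a • x) (matForm S) = a ^ 2 * eval x (matForm S) := by
  rw [eval_matForm, eval_matForm, Matrix.mulVec_smul, smul_dotProduct, dotProduct_smul, smul_eq_mul,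
    smul_eq_mul]
  ring

theorem mem_cone_commonZeros {x : Fin (N + 1) → ℂ} :
    x ∈ cone (commonZeros (matForm S) (matForm T)) ↔
      x ≠ 0 ∧ eval x (matForm S) = 0 ∧ eval x (matForm T) = 0 := by
  simp only [cone, commonZeros, Set.mem_ofPred_eq, ← exists_prop (a := x ≠ 0)]
  refine exists_congr fun hx => ?_
  obtain ⟨a, ha⟩ := Projectivization.exists_smul_eq_mk_rep ℂ x hx
  rw [← ha]
  have ha0 : (a : ℂ) ^ 2 ≠ 0 := pow_ne_zero _ a.ne_zero
  change eval ((a : ℂ) • x) _ = 0 ∧ eval ((a : ℂ) • x) _ = 0 ↔ _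
  rw [eval_smul_matForm, eval_smul_matForm, mul_eq_zero, mul_eq_zero, or_iff_right ha0,
    or_iff_right ha0]

/-- Elements of an ideal generated by quadratic forms have no linear terms. -/
theorem eval_pderiv_zero_of_mem {f : MvPolynomial (Fin (N + 1)) ℂ} (hS : S.IsSymm) (hT : T.IsSymm)
    (hf : f ∈ Ideal.span {matForm S, matForm T}) (i : Fin (N + 1)) :
    eval 0 (pderiv i f) = 0 := by
  obtain ⟨a, b, rfl⟩ := Ideal.mem_span_pair.1 hf
  simp only [map_add, Derivation.leibniz, smul_eq_mul, map_mul, eval_pderiv_matForm hS,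
    eval_pderiv_matForm hT, eval_matForm, Matrix.mulVec_zero, Pi.zero_apply, dotProduct_zero]
  ring

/-- The cone omits the origin, so the Nullstellensatz is applied to X_0 f instead of f. Primality
removes X_0, which is not in the ideal because its elements have no linear terms. -/
theorem projIdeal_commonZeros (hS : S.IsSymm) (hT : T.IsSymm)
    (hI : (Ideal.span {matForm S, matForm T}).IsPrime) :
    projIdeal (commonZeros (matForm S) (matForm T)) = Ideal.span {matForm S, matForm T} := by
  refine le_antisymm (fun f hf => ?_) (Ideal.span_le.2 ?_)
  · have hX : (X 0 : MvPolynomial (Fin (N + 1)) ℂ) ∉ Ideal.span {matForm S, matForm T} := by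
      intro h
      have := eval_pderiv_zero_of_mem hS hT h 0
      simp at this
    refine (hI.mem_or_mem (x := X 0) (y := f) ?_).resolve_left hX
    rw [← IsPrime.vanishingIdeal_zeroLocus (K := ℂ) (Ideal.span {matForm S, matForm T})]
    intro x hx
    rw [map_mul, aeval_X]
    by_cases h0 : x = 0
    · simp [h0]
    · have : x ∈ cone (commonZeros (matForm S) (matForm T)) :=
        mem_cone_commonZeros.2 ⟨h0, hx _ (Ideal.subset_span (by simp)),
          hx _ (Ideal.subset_span (by simp))⟩
      rw [hf x this, mul_zero]
  · rintro p (rfl | rfl) x hx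
    · exact (mem_cone_commonZeros.1 hx).2.1
    · exact (mem_cone_commonZeros.1 hx).2.2

/-- The sets `{f ≠ 0}` form a basis of the Zariski topology. -/
theorem exists_basic_open_subset {U : Set (PSpace N)} (hU : @IsOpen _ (zariski N) U) :
    ∀ p ∈ U, ∃ (d : ℕ) (f : MvPolynomial (Fin (N + 1)) ℂ), f.IsHomogeneous d ∧
      eval p.rep f ≠ 0 ∧ {q : PSpace N | eval q.rep f ≠ 0} ⊆ U := by
  induction hU with
  | basic U h =>
    obtain ⟨d, f, hf, rfl⟩ := h
    exact fun p hp => ⟨d, f, hf, hp, subset_rfl⟩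
  | univ => exact fun p _ => ⟨0, 1, isHomogeneous_one _ _, by simp, Set.subset_univ _⟩
  | inter U V _ _ hU hV =>
    rintro p ⟨h1, h2⟩
    obtain ⟨d, f, hf, hfp, hfU⟩ := hU p h1
    obtain ⟨e, g, hg, hgp, hgV⟩ := hV p h2
    refine ⟨d + e, f * g, hf.mul hg, by rw [map_mul]; exact mul_ne_zero hfp hgp, fun q hq => ?_⟩
    rw [Set.mem_ofPred_eq, map_mul] at hq
    exact ⟨hfU (left_ne_zero_of_mul hq), hgV (right_ne_zero_of_mul hq)⟩
  | sUnion 𝒰 _ h =>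
    rintro p ⟨U, hU, hp⟩
    obtain ⟨d, f, hf, hfp, hfU⟩ := h U hU p hp
    exact ⟨d, f, hf, hfp, hfU.trans (Set.subset_sUnion_of_mem hU)⟩

theorem eval_rep_ne_zero_iff {d : ℕ} {f : MvPolynomial (Fin (N + 1)) ℂ} (hf : f.IsHomogeneous d)
    {x : Fin (N + 1) → ℂ} (hx : x ≠ 0) :
    eval (Projectivization.mk ℂ x hx).rep f ≠ 0 ↔ eval x f ≠ 0 := by
  obtain ⟨a, ha⟩ := Projectivization.exists_smul_eq_mk_rep ℂ x hx
  rw [← ha]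
  have : eval ((a : ℂ) • x) f = (a : ℂ) ^ d * eval x f := by
    rw [eval_eq, eval_eq, Finset.mul_sum]
    refine Finset.sum_congr rfl fun s hs => ?_
    have hd : ∑ i ∈ s.support, s i = d := (hf.degree_eq_sum_deg_support hs).symm
    simp only [Pi.smul_apply, smul_eq_mul, mul_pow, Finset.prod_mul_distrib,
      Finset.prod_pow_eq_pow_sum, hd]
    ring
  change eval ((a : ℂ) • x) f ≠ 0 ↔ _
  rw [this]
  simp

/-- A closed subset of projective space with a prime homogeneous ideal is irreducible. -/
theorem isIrreducible_of_isPrime {Z : Set (PSpace N)} (h : (projIdeal Z).IsPrime) :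
    @IsIrreducible _ (zariski N) Z := by
  have hne : ∀ f : MvPolynomial (Fin (N + 1)) ℂ, f ∉ projIdeal Z →
      ∃ (x : _) (hx : x ≠ 0), Projectivization.mk ℂ x hx ∈ Z ∧ eval x f ≠ 0 := by
    intro f hf
    by_contra! hcon
    exact hf fun x ⟨hx, hxZ⟩ => hcon x hx hxZ
  have hnot : ∀ {d} {f : MvPolynomial (Fin (N + 1)) ℂ} {p : PSpace N}, f.IsHomogeneous d → p ∈ Z →
      eval p.rep f ≠ 0 → f ∉ projIdeal Z := by
    intro d f p _ hp hfp hf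
    exact hfp (hf p.rep ⟨p.rep_nonzero, by rwa [p.mk_rep]⟩)
  refine ⟨?_, ?_⟩
  · obtain ⟨x, hx, hxZ, _⟩ := hne 1 (fun h1 => h.ne_top ((Ideal.eq_top_iff_one _).2 h1))
    exact ⟨_, hxZ⟩
  · rintro U V hU hV ⟨p, hpZ, hpU⟩ ⟨q, hqZ, hqV⟩
    obtain ⟨d, f, hf, hfp, hfU⟩ := exists_basic_open_subset hU p hpU
    obtain ⟨e, g, hg, hgq, hgV⟩ := exists_basic_open_subset hV q hqV
    have hfg : f * g ∉ projIdeal Z := fun hfg =>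
      (h.mem_or_mem hfg).elim (hnot hf hpZ hfp) (hnot hg hqZ hgq)
    obtain ⟨x, hx, hxZ, hxf⟩ := hne _ hfg
    rw [map_mul] at hxf
    exact ⟨_, hxZ, hfU ((eval_rep_ne_zero_iff hf hx).2 (left_ne_zero_of_mul hxf)),
      hgV ((eval_rep_ne_zero_iff hg hx).2 (right_ne_zero_of_mul hxf))⟩

/-- Krull's height theorem gives the upper bound, and the chain of primes 0 ⊂ (S) ⊂ (S, T) the lower
one. -/
theorem height_span_pair_eq_two (hS : S.IsSymm) (hT : T.IsSymm)
    (hSr : 5 ≤ S.rank) (hmem : ∀ t : ℂ, 3 ≤ (T + t • S).rank) :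
    (Ideal.span {matForm S, matForm T}).height = 2 := by
  have hI := isPrime_span_pair hS hT hSr hmem
  have hSp : Prime (matForm S) := (irreducible_matForm hS (by omega)).prime
  have hSI : (Ideal.span {matForm S}).IsPrime := (Ideal.span_singleton_prime hSp.ne_zero).2 hSp
  refine le_antisymm ?_ ?_
  · classical
    have h1 : Ideal.span {matForm S, matForm T} ∈
        (Ideal.span (({matForm S, matForm T} : Finset _) : Set _)).minimalPrimes := by
      rw [Finset.coe_pair, Ideal.minimalPrimes_eq_subsingleton_self]
      rfl
    refine (Ideal.height_le_card_of_mem_minimalPrimes_span_finset h1).trans ?_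
    exact_mod_cast Finset.card_le_two
  · have h1 : (⊥ : Ideal (MvPolynomial (Fin (N + 1)) ℂ)) < Ideal.span {matForm S} :=
      bot_lt_iff_ne_bot.2 fun h => hSp.ne_zero (Ideal.span_singleton_eq_bot.1 h)
    have h2 : Ideal.span {matForm S} < Ideal.span {matForm S, matForm T} := by
      refine lt_of_le_of_ne (Ideal.span_mono (by simp)) fun h => not_dvd_matForm hS hT hmem ?_
      rw [← Ideal.mem_span_singleton, h]
      exact Ideal.subset_span (by simp)
    have h3 := Ideal.height_add_one_le_of_lt_of_isPrime h1
    have h4 := Ideal.height_add_one_le_of_lt_of_isPrime h2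
    rw [Ideal.height_bot, zero_add] at h3
    calc (2 : ℕ∞) = 1 + 1 := by norm_num
      _ ≤ _ := (by gcongr : (1 : ℕ∞) + 1 ≤ _ + 1).trans h4

/-- At a singular point the gradients of the two forms are linearly dependent. -/
theorem exists_comb_mulVec_eq_zero (hS : S.IsSymm) (hT : T.IsSymm)
    (hcod : projCodim (commonZeros (matForm S) (matForm T)) = 2) {x : Fin (N + 1) → ℂ}
    (hx : x ∈ cone (singularLocus (commonZeros (matForm S) (matForm T)))) :
    ∃ a b : ℂ, (a ≠ 0 ∨ b ≠ 0) ∧ a • S.mulVec x + b • T.mulVec x = 0 := by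
  obtain ⟨hx0, -, hp⟩ := hx
  rw [hcod] at hp
  set p := Projectivization.mk ℂ x hx0 with hpdef
  have hgr : ∀ {U : Matrix (Fin (N + 1)) (Fin (N + 1)) ℂ}, U.IsSymm →
      gradient (matForm U) p.rep = (2 : ℂ) • U.mulVec p.rep := fun hU => by
    funext i
    exact eval_pderiv_matForm hU _ i
  have hmem : ∀ {U : Matrix (Fin (N + 1)) (Fin (N + 1)) ℂ},
      (∀ y ∈ cone (commonZeros (matForm S) (matForm T)), eval y (matForm U) = 0) → U.IsSymm →
      (2 : ℂ) • U.mulVec p.rep ∈ Submodule.span ℂ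
        {v | ∃ f ∈ projIdeal (commonZeros (matForm S) (matForm T)), v = gradient f p.rep} :=
    fun {U} h hU => Submodule.subset_span ⟨matForm U, fun y hy => h y hy, (hgr hU).symm⟩
  -- Independent gradients would span dimension 2, the codimension, so the point would not be
  -- singular.
  have hdep : ¬ LinearIndependent ℂ ![(2 : ℂ) • S.mulVec p.rep, (2 : ℂ) • T.mulVec p.rep] := by
    intro hli
    have h1 := finrank_span_eq_card hli
    have h2 := Submodule.finrank_mono (Submodule.span_le.2 (show Set.range
      ![(2 : ℂ) • S.mulVec p.rep, (2 : ℂ) • T.mulVec p.rep] ⊆ Submodule.span ℂ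
        {v | ∃ f ∈ projIdeal (commonZeros (matForm S) (matForm T)), v = gradient f p.rep} from by
      rintro _ ⟨i, rfl⟩
      fin_cases i
      · exact hmem (fun y hy => (mem_cone_commonZeros.1 hy).2.1) hS
      · exact hmem (fun y hy => (mem_cone_commonZeros.1 hy).2.2) hT))
    rw [h1, Fintype.card_fin] at h2
    exact absurd hp (not_lt.2 (by exact_mod_cast h2))
  rw [LinearIndependent.pair_iff] at hdep
  push Not at hdep
  obtain ⟨a, b, hab, hne⟩ := hdep
  obtain ⟨r, hr⟩ := Projectivization.exists_smul_eq_mk_rep ℂ x hx0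
  refine ⟨a, b, ?_, ?_⟩
  · by_cases ha : a = 0
    · exact Or.inr (hne ha)
    · exact Or.inl ha
  · rw [← hpdef] at hr
    rw [← hr] at hab
    have h1 : (2 * (r : ℂ)) • (a • S.mulVec x + b • T.mulVec x) = 0 := by
      rw [← hab, Units.smul_def, Matrix.mulVec_smul, Matrix.mulVec_smul]
      module
    exact (smul_eq_zero.1 h1).resolve_left (mul_ne_zero two_ne_zero r.ne_zero)

/-- A pair of quadratic forms is regular if all members of its pencil have rank at least 6 and
one of the two forms has rank at least 7. -/
theorem mem_regularPairs {c : PairSpace N}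
    (h01 : ∀ t : ℂ, 6 ≤ (pairMat c 0 - t • pairMat c 1).rank)
    (h10 : ∀ t : ℂ, 6 ≤ (pairMat c 1 - t • pairMat c 0).rank)
    (h7 : ∃ i, 7 ≤ (pairMat c i).rank) : c ∈ regularPairs N := by
  have hS := pairMat_isSymm c 0
  have hT := pairMat_isSymm c 1
  have h01' : ∀ t : ℂ, 6 ≤ (pairMat c 0 + t • pairMat c 1).rank := fun t => by
    simpa using h01 (-t)
  have h10' : ∀ t : ℂ, 6 ≤ (pairMat c 1 + t • pairMat c 0).rank := fun t => by
    simpa using h10 (-t)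
  have hSr : 6 ≤ (pairMat c 0).rank := by simpa using h01 0
  have hTr : 6 ≤ (pairMat c 1).rank := by simpa using h10 0
  have hmem : ∀ t : ℂ, 3 ≤ (pairMat c 1 + t • pairMat c 0).rank := fun t => by
    have := h10' t
    omega
  have hI := isPrime_span_pair hS hT (by omega) hmem
  have hproj := projIdeal_commonZeros hS hT hI
  have hcod : projCodim (commonZeros (matForm (pairMat c 0)) (matForm (pairMat c 1))) = 2 := by
    change (projIdeal _).height = 2
    rw [hproj]
    exact height_span_pair_eq_two hS hT (by omega) hmem
  rw [regularPairs, Set.mem_ofPred_eq, quadForm_eq, quadForm_eq]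
  refine ⟨⟨isIrreducible_of_isPrime (by rw [hproj]; exact hI), hcod, hproj⟩, ?_⟩
  have hred : ∀ {A B : Matrix (Fin (N + 1)) (Fin (N + 1)) ℂ} {a b : ℂ} {x : Fin (N + 1) → ℂ},
      (a ≠ 0 ∨ b ≠ 0) → a • A.mulVec x + b • B.mulVec x = 0 →
      A.mulVec x = 0 ∨ ∃ t : ℂ, (B + t • A).mulVec x = 0 := by
    intro A B a b x hab h
    by_cases hb : b = 0
    · left
      rw [hb, zero_smul, add_zero] at h
      exact (smul_eq_zero.1 h).resolve_left (by tauto)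
    · right
      refine ⟨b⁻¹ * a, ?_⟩
      have h1 : b⁻¹ • (a • A.mulVec x + b • B.mulVec x) = 0 := by rw [h, smul_zero]
      rw [smul_add, smul_smul, smul_smul, inv_mul_cancel₀ hb, one_smul] at h1
      rw [Matrix.add_mulVec, Matrix.smul_mulVec, add_comm (B.mulVec x)]
      exact h1
  obtain ⟨i, hi⟩ := h7
  -- The form of rank at least 7 takes the role of `B`, the member at t = 0, so that the generic
  -- kernel has codimension at least 7.
  fin_cases i
  · refine le_trans ?_ (affineCodim_anti (T := {x | (pairMat c 1).mulVec x = 0 ∨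
      ∃ t : ℂ, (pairMat c 0 + t • pairMat c 1).mulVec x = 0}) fun x hx => ?_)
    · exact_mod_cast le_affineCodim_pencil_ker (r := 6) hTr h01' hi
    · obtain ⟨a, b, hab, h⟩ := exists_comb_mulVec_eq_zero hS hT hcod hx
      exact hred hab.symm ((add_comm _ _).trans h)
  · refine le_trans ?_ (affineCodim_anti (T := {x | (pairMat c 0).mulVec x = 0 ∨
      ∃ t : ℂ, (pairMat c 1 + t • pairMat c 0).mulVec x = 0}) fun x hx => ?_)
    · exact_mod_cast le_affineCodim_pencil_ker (r := 6) hSr h10' hi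
    · obtain ⟨a, b, hab, h⟩ := exists_comb_mulVec_eq_zero hS hT hcod hx
      exact hred hab h

end Regular

end TwoQuadrics

/-- The factors N-4 and N-3 are consecutive with product at least 20, so division and subtraction of
natural numbers are exact here. -/
theorem proposition2p3 (N : ℕ) (hN : 8 ≤ N) :
    (((N - 4) * (N - 3) / 2 - 2 : ℕ) : ℕ∞) ≤
      TwoQuadrics.affineCodim (TwoQuadrics.regularPairs N)ᶜ := by
  refine le_trans (TwoQuadrics.le_affineCodim_union (TwoQuadrics.le_affineCodim_union
    (TwoQuadrics.le_affineCodim_rank_add_smul hN 0 1 (by decide))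
    (TwoQuadrics.le_affineCodim_rank_add_smul hN 1 0 (by decide)))
    (TwoQuadrics.le_affineCodim_rank_le_six hN)) (TwoQuadrics.affineCodim_anti fun c hc => ?_)
  by_contra hcon
  simp only [Set.mem_union, Set.mem_ofPred_eq, not_or, not_exists, not_forall, not_le] at hcon
  obtain ⟨⟨h1, h2⟩, h3⟩ := hcon
  exact hc (TwoQuadrics.mem_regularPairs h1 h2 h3)
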